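/- There is an absolute constant $c$ such that for every finite abelian group $G$ (written additively) the following problem is solved by a random access machine program (depending only on $G$ and on a numbering of its elements) which, on every instance with $n+m\ge 2$, halts within $(n+m)^{|G|+c}$ steps. Instance: Boolean variables $x_1,\dots,x_n$; $m$ clauses $y\vee z$, where $y,z$ are literals (variables or negated variables, possibly of the same variable); maps $g_1,\dots,g_n:\{0,1\}\to G$; and a set $S\subseteq G$. Task: output an assignment $x\in\{0,1\}^n$ that satisfies all clauses and the global constraint $\sum_{j=1}^n g_j(x_j)\in S$, or report correctly that no such assignment exists. (The program halts with a correct answer also when $n+m\le 1$.) Machine model: the memory consists of registers and finitely many arrays of natural numbers, and initially holds $n$, $m$, the clauses, the numbers of the elements $g_j(0),g_j(1)$ and the indicator function of $S$. Programs are built from assignments, array accesses with computed index, successor, predecessor and comparison by sequencing, conditionals and while loops; each elementary operation costs one step. -/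

import Mathlib

universe u

/-! ## Random access machine programs with a step count

The memory consists of scalar registers and of named one-dimensional arrays, all holding natural
numbers. Arithmetic is limited to successor, (truncated) predecessor and comparison, so during a
computation of `t` steps no number exceeds `t` plus the largest number in the input and the
program text; charging one step per elementary operation is therefore realistic. -/

namespace RAM

/-- Memory contents: scalar registers and arrays. -/
structure State where
  scalar : ℕ → ℕ
  array : ℕ → ℕ → ℕ

/-- Overwrite the scalar register `x` by `v`. -/
def State.setScalar (s : State) (x v : ℕ) : State where
  scalar := fun y => if y = x then v else s.scalar y
  array := s.array

/-- Overwrite the `i`-th cell of the array `a` by `v`. -/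
def State.setCell (s : State) (a i v : ℕ) : State where
  scalar := s.scalar
  array := fun b j => if b = a ∧ j = i then v else s.array b j

/-- Expressions; `cell a i` is the content of the `i`-th cell of the array named `a`, where the
name `a` is fixed in the program and the index `i` is computed. -/
inductive Expr where
  | const (k : ℕ)
  | scalar (x : ℕ)
  | cell (a : ℕ) (i : Expr)
  | succ (e : Expr)
  | pred (e : Expr)

/-- Value of an expression. -/
def Expr.eval : Expr → State → ℕ
  | .const k, _ => k
  | .scalar x, s => s.scalar x
  | .cell a i, s => s.array a (i.eval s)
  | .succ e, s => e.eval s + 1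
  | .pred e, s => e.eval s - 1

/-- Number of steps spent on evaluating an expression: one per operation. -/
def Expr.cost : Expr → ℕ
  | .const _ => 1
  | .scalar _ => 1
  | .cell _ i => i.cost + 1
  | .succ e => e.cost + 1
  | .pred e => e.cost + 1

/-- Comparisons of two expressions. -/
inductive Test where
  | eq (e f : Expr)
  | lt (e f : Expr)

/-- Outcome of a comparison. -/
def Test.Holds : Test → State → Prop
  | .eq e f, s => e.eval s = f.eval s
  | .lt e f, s => e.eval s < f.eval s

/-- Number of steps spent on a comparison. -/
def Test.cost : Test → ℕ
  | .eq e f => e.cost + f.cost + 1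
  | .lt e f => e.cost + f.cost + 1

/-- Programs. A program is a finite text, hence uses finitely many registers and arrays. -/
inductive Program where
  | skip
  | setScalar (x : ℕ) (e : Expr)
  | setCell (a : ℕ) (i e : Expr)
  | seq (P Q : Program)
  | ifThenElse (b : Test) (P Q : Program)
  | whileDo (b : Test) (P : Program)

/-- `Exec P s s' t`: started with memory contents `s`, the program `P` halts after exactly `t`
steps, and then the memory contents are `s'`. -/
inductive Exec : Program → State → State → ℕ → Prop
  | skip (s : State) : Exec .skip s s 1
  | setScalar (x : ℕ) (e : Expr) (s : State) :
      Exec (.setScalar x e) s (s.setScalar x (e.eval s)) (e.cost + 1)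
  | setCell (a : ℕ) (i e : Expr) (s : State) :
      Exec (.setCell a i e) s (s.setCell a (i.eval s) (e.eval s)) (i.cost + e.cost + 1)
  | seq {P Q : Program} {s s' s'' : State} {t t' : ℕ} :
      Exec P s s' t → Exec Q s' s'' t' → Exec (.seq P Q) s s'' (t + t')
  | ifTrue {b : Test} {P Q : Program} {s s' : State} {t : ℕ} :
      b.Holds s → Exec P s s' t → Exec (.ifThenElse b P Q) s s' (b.cost + t)
  | ifFalse {b : Test} {P Q : Program} {s s' : State} {t : ℕ} :
      ¬ b.Holds s → Exec Q s s' t → Exec (.ifThenElse b P Q) s s' (b.cost + t)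
  | whileTrue {b : Test} {P : Program} {s s' s'' : State} {t t' : ℕ} :
      b.Holds s → Exec P s s' t → Exec (.whileDo b P) s' s'' t' →
      Exec (.whileDo b P) s s'' (b.cost + t + t')
  | whileFalse {b : Test} {P : Program} {s : State} :
      ¬ b.Holds s → Exec (.whileDo b P) s s b.cost

/-- Execution is deterministic: the final memory and the number of steps are determined by the
program and the initial memory. -/
theorem Exec.deterministic {P : Program} {s s₁ s₂ : State} {t₁ t₂ : ℕ}
    (h₁ : Exec P s s₁ t₁) (h₂ : Exec P s s₂ t₂) : s₁ = s₂ ∧ t₁ = t₂ := by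
  induction h₁ generalizing s₂ t₂ with
  | skip | setScalar | setCell => cases h₂; exact ⟨rfl, rfl⟩
  | seq _ _ ih ih' =>
    cases h₂ with
    | seq k k' =>
      obtain ⟨rfl, rfl⟩ := ih k
      obtain ⟨rfl, rfl⟩ := ih' k'
      exact ⟨rfl, rfl⟩
  | ifTrue hb _ ih =>
    cases h₂ with
    | ifTrue _ k => obtain ⟨rfl, rfl⟩ := ih k; exact ⟨rfl, rfl⟩
    | ifFalse hb' _ => exact absurd hb hb'
  | ifFalse hb _ ih =>
    cases h₂ with
    | ifTrue hb' _ => exact absurd hb' hb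
    | ifFalse _ k => obtain ⟨rfl, rfl⟩ := ih k; exact ⟨rfl, rfl⟩
  | whileTrue hb _ _ ih ih' =>
    cases h₂ with
    | whileTrue _ k k' =>
      obtain ⟨rfl, rfl⟩ := ih k
      obtain ⟨rfl, rfl⟩ := ih' k'
      exact ⟨rfl, rfl⟩
    | whileFalse hb' => exact absurd hb hb'
  | whileFalse hb =>
    cases h₂ with
    | whileTrue hb' _ _ => exact absurd hb' hb
    | whileFalse => exact ⟨rfl, rfl⟩

end RAM

/-! ## 2-SAT with a global constraint in an abelian group -/

/-- A literal over `n` Boolean variables: `(i, true)` is the `i`-th variable and `(i, false)` is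
its negation. -/
abbrev Literal (n : ℕ) : Type := Fin n × Bool

/-- The literal `l` is true under the assignment `x`. -/
def Literal.IsTrue {n : ℕ} (l : Literal n) (x : Fin n → Bool) : Prop := x l.1 = l.2

/-- An instance with `n` variables and `m` two-literal clauses (the two literals of a clause may
involve the same variable), and the global constraint `∑ j, weight j (x j) ∈ target`. -/
structure TwoSatMod (G : Type u) (n m : ℕ) where
  clause : Fin m → Literal n × Literal n
  weight : Fin n → Bool → G
  target : Set G

namespace TwoSatMod

variable {G : Type u} {n m : ℕ}

/-- The assignment `x` satisfies all clauses and the global constraint. -/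
def IsSolution [AddCommGroup G] (Φ : TwoSatMod G n m) (x : Fin n → Bool) : Prop :=
  (∀ k, (Φ.clause k).1.IsTrue x ∨ (Φ.clause k).2.IsTrue x) ∧
    ∑ j, Φ.weight j (x j) ∈ Φ.target

open Classical in
/-- The memory contents presenting the instance `Φ` to a program, where the elements of `G` are
numbered by `e`: scalar registers 0 and 1 hold `n` and `m`; arrays 0 and 1 hold the variable and
the sign of the first literal of each clause, arrays 2 and 3 those of the second literal; arrays
4 and 5 hold the numbers of `weight j false` and `weight j true`; array 6 holds the indicator
function of the target set. All the rest is 0. -/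
noncomputable def input (e : G ≃ Fin (Nat.card G)) (Φ : TwoSatMod G n m) : RAM.State where
  scalar
    | 0 => n
    | 1 => m
    | _ => 0
  array
    | 0, k => if h : k < m then (Φ.clause ⟨k, h⟩).1.1 else 0
    | 1, k => if h : k < m then (Φ.clause ⟨k, h⟩).1.2.toNat else 0
    | 2, k => if h : k < m then (Φ.clause ⟨k, h⟩).2.1 else 0
    | 3, k => if h : k < m then (Φ.clause ⟨k, h⟩).2.2.toNat else 0
    | 4, j => if h : j < n then e (Φ.weight ⟨j, h⟩ false) else 0
    | 5, j => if h : j < n then e (Φ.weight ⟨j, h⟩ true) else 0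
    | 6, i => if h : i < Nat.card G then (if e.symm ⟨i, h⟩ ∈ Φ.target then 1 else 0) else 0
    | _, _ => 0

/-- The memory contents `s` are a correct answer for `Φ`: either scalar register 0 holds 1 and
array 7 holds a solution, or scalar register 0 holds 0 and there is no solution. -/
def IsAnswer [AddCommGroup G] (Φ : TwoSatMod G n m) (s : RAM.State) : Prop :=
  (s.scalar 0 = 1 ∧ ∃ x, Φ.IsSolution x ∧ ∀ j : Fin n, s.array 7 j = (x j).toNat) ∨
    (s.scalar 0 = 0 ∧ ∀ x, ¬ Φ.IsSolution x)

end TwoSatMod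

/-! ## Zero-sum subsets -/

/-! Fix an assignment `y` satisfying all clauses, and let `z` be a solution differing from `y` on a
set `T` of least size. A variable of `T` reaches another if its literal true under `z` implies the
other's through a chain of clauses. Let `A ⊆ T` be a smallest set from which all of `T` is reached;
no element of `A` reaches another. Suppose `A` has at least `|G|` elements. The sets `C a` of
elements of `T` reaching `a ∈ A` are pairwise disjoint, and among the weight differences between `z`
and `y` on them a nonempty subfamily sums to zero. Resetting `z` to `y` on the union of this
subfamily violates no clause, since the union is closed under predecessors in `T`; it keeps the
global sum and moves `z` closer to `y`, a contradiction. So `z` arises from `y` by imposing the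
consequences of at most `|G| - 1` literals (`hits_of_isSolution`).

Consequences are computed by unit propagation. Started with a literal true under `z`, it assigns
only values of `z` (`propagate_below`) and assigns everything reachable (`Closed.of_reflTransGen`).
Overriding a satisfying assignment by a closed partial one leaves it satisfying
(`Satisfies.extend`), so the search may try all choices of literals blindly and test only the global
constraint. The same principle finds `y` without backtracking.

The search has about `n ^ (|G| - 1)` leaves. A factor growing with `|G|` at each leaf would spoil an
absolute `c`, so addition in `G` is compiled beforehand into pointer tables. These cost `n` times a
cubic in `|G|`, which is paid for by `2 ^ |G|`. -/

theorem exists_nonempty_subset_sum_eq_zero {ι : Type*} {G : Type*} [AddCommGroup G] [Finite G]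
    (A : Finset ι) (w : ι → G) (h : Nat.card G ≤ A.card) :
    ∃ B ⊆ A, B.Nonempty ∧ ∑ a ∈ B, w a = 0 := by
  classical
  have := Fintype.ofFinite G
  rw [Nat.card_eq_fintype_card] at h
  let f := A.equivFin.symm
  -- Pigeonhole on the `A.card + 1` sums over initial segments of an enumeration of `A`: two agree,
  -- and the difference of the segments has sum zero.
  let pre : ℕ → Finset ι := fun i =>
    (Finset.univ.filter fun a : Fin A.card => (a : ℕ) < i).map
      (f.toEmbedding.trans (Function.Embedding.subtype _))
  obtain ⟨i, hi, j, hj, hij, he⟩ := Finset.exists_ne_map_eq_of_card_lt_of_maps_to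
    (s := Finset.range (A.card + 1)) (t := (Finset.univ : Finset G))
    (f := fun i => ∑ a ∈ pre i, w a) (by simpa using by omega) (fun _ _ => by simp)
  wlog hlt : i < j generalizing i j
  · exact this j hj i hi hij.symm he.symm (by omega)
  have hsub : pre i ⊆ pre j := by
    apply Finset.map_subset_map.2
    intro a ha
    simp only [Finset.mem_filter, Finset.mem_univ, true_and] at ha ⊢
    omega
  refine ⟨pre j \ pre i, ?_, ?_, ?_⟩
  · intro x hx
    obtain ⟨a, -, rfl⟩ := Finset.mem_map.1 (Finset.mem_sdiff.1 hx).1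
    exact (f a).2
  · have hi' : i < A.card := by
      have := Finset.mem_range.1 hj
      omega
    refine ⟨f ⟨i, hi'⟩, Finset.mem_sdiff.2 ⟨?_, ?_⟩⟩
    · exact Finset.mem_map.2 ⟨⟨i, hi'⟩, by simpa using hlt, rfl⟩
    · intro hmem
      obtain ⟨a, ha, hae⟩ := Finset.mem_map.1 hmem
      have : a = ⟨i, hi'⟩ := f.injective (Subtype.ext hae)
      subst this
      simp at ha
  · have := Finset.sum_sdiff hsub (f := w)
    rw [he] at this
    simpa using this

/-! ## Iterating an operation that increases a measure unless it does nothing -/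

/-- As long as no fixed point is reached, each iteration raises the measure by at least one, which
can happen at most `N` times. -/
theorem Function.iterate_isFixedPt_of_measure {α : Type*} (f : α → α) (μ : α → ℕ) (N : ℕ)
    (hf : ∀ a, f a = a ∨ μ a < μ (f a)) (hμ : ∀ a, μ a ≤ N) (a : α) :
    f (f^[N] a) = f^[N] a := by
  have key : ∀ k, f (f^[k] a) = f^[k] a ∨ k ≤ μ (f^[k] a) := by
    intro k
    induction k with
    | zero => right; simp
    | succ k ih =>
      rw [Function.iterate_succ_apply']
      rcases hf (f^[k] a) with h | h
      · left; rw [h, h]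
      · rcases ih with ih | ih
        · left; rw [ih, ih]
        · right; omega
  rcases key N with h | h
  · exact h
  · rcases hf (f^[N] a) with h' | h'
    · exact h'
    · have := hμ (f (f^[N] a)); omega

namespace TwoSatMod

/-! ## Unit propagation -/

/-- A partial assignment together with a flag that reports a conflict. -/
abbrev Partial (n : ℕ) : Type := (Fin n → Option Bool) × Bool

variable {G : Type u} {n m : ℕ}

/-- If the literal `l` is false, make the literal `l'` true, or report a conflict. -/
def force (l l' : Literal n) (s : Partial n) : Partial n :=
  if s.1 l.1 = some (!l.2) then
    if s.1 l'.1 = none then (Function.update s.1 l'.1 (some l'.2), s.2)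
    else if s.1 l'.1 = some l'.2 then s else (s.1, true)
  else s

/-- Number of assigned variables, plus one in case of a conflict. -/
def Partial.size (s : Partial n) : ℕ :=
  (Finset.univ.filter fun v => s.1 v ≠ none).card + s.2.toNat

theorem Partial.size_le (s : Partial n) : s.size ≤ n + 1 := by
  have h := Finset.card_filter_le (Finset.univ : Finset (Fin n)) fun v => s.1 v ≠ none
  have h' := Bool.toNat_le s.2
  simp only [Finset.card_univ, Fintype.card_fin] at h
  unfold Partial.size
  omega

/-- Values are never revoked and the flag is never cleared, so any change is strict progress. This
bounds the number of sweeps. -/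
theorem force_eq_or_size_lt (l l' : Literal n) (s : Partial n) :
    force l l' s = s ∨ s.size < (force l l' s).size := by
  unfold force
  split_ifs with h1 h2 h3
  · right
    unfold Partial.size
    refine Nat.add_lt_add_right (Finset.card_lt_card ?_) _
    rw [Finset.ssubset_iff_of_subset]
    · exact ⟨l'.1, by simp, by simpa using h2⟩
    · intro v hv
      simp only [Finset.mem_filter, Finset.mem_univ, true_and] at hv ⊢
      by_cases hvl : v = l'.1
      · subst hvl; simp
      · simpa [hvl] using hv
  · exact .inl rfl
  · cases hs : s.2 with
    | true => exact .inl (Prod.ext rfl hs.symm)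
    | false => right; simp [Partial.size, hs]
  · exact .inl rfl

theorem force_extends {l l' : Literal n} {s : Partial n} {v : Fin n} {b : Bool}
    (h : s.1 v = some b) : (force l l' s).1 v = some b := by
  unfold force
  split_ifs with h1 h2 h3
  · have : v ≠ l'.1 := by rintro rfl; simp [h2] at h
    simpa [this] using h
  all_goals exact h

/-- `z` extends the partial assignment, and no conflict has been reported. -/
def Partial.Below (s : Partial n) (z : Fin n → Bool) : Prop :=
  s.2 = false ∧ ∀ v b, s.1 v = some b → z v = b

/-- Soundness of propagation: if `l` is false under `s`, it is false under `z`, so `z` makes `l'`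
true. Hence the forced value is that of `z`, and a conflict cannot arise. -/
theorem Partial.Below.force {s : Partial n} {z : Fin n → Bool} (h : s.Below z)
    {l l' : Literal n} (hz : l.IsTrue z ∨ l'.IsTrue z) : (force l l' s).Below z := by
  unfold TwoSatMod.force
  split_ifs with h1 h2 h3
  · have hl' : z l'.1 = l'.2 := by
      rcases hz with hz | hz
      · have := h.2 _ _ h1
        rw [Literal.IsTrue] at hz
        simp [hz] at this
      · exact hz
    refine ⟨h.1, fun v b hv => ?_⟩
    by_cases hvl : v = l'.1
    · subst hvl
      simp at hv
      rw [hl', hv]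
    · exact h.2 v b (by simpa [hvl] using hv)
  · exact h
  · exfalso
    have hl' : z l'.1 = l'.2 := by
      rcases hz with hz | hz
      · have := h.2 _ _ h1
        rw [Literal.IsTrue] at hz
        simp [hz] at this
      · exact hz
    obtain ⟨b, hb⟩ := Option.ne_none_iff_exists'.1 h2
    have := h.2 _ _ hb
    rw [hb, ← this, hl'] at h3
    exact h3 rfl
  · exact h

theorem force_isFixed {l l' : Literal n} {s : Partial n} (hs : s.2 = false)
    (h : force l l' s = s) (hl : s.1 l.1 = some (!l.2)) : s.1 l'.1 = some l'.2 := by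
  unfold force at h
  rw [if_pos hl] at h
  split_ifs at h with h2 h3
  · have := congrFun (congrArg Prod.fst h) l'.1
    simpa using this.symm
  · exact h3
  · have := congrArg Prod.snd h
    simp [hs] at this

/-- Propagation along the clause number `k`, in both directions. -/
def clauseStep (Φ : TwoSatMod G n m) (k : ℕ) (s : Partial n) : Partial n :=
  if h : k < m then
    force (Φ.clause ⟨k, h⟩).2 (Φ.clause ⟨k, h⟩).1 (force (Φ.clause ⟨k, h⟩).1 (Φ.clause ⟨k, h⟩).2 s)
  else s

/-- Propagation along the first `k` clauses. -/
def sweep (Φ : TwoSatMod G n m) : ℕ → Partial n → Partial n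
  | 0, s => s
  | k + 1, s => clauseStep Φ k (sweep Φ k s)

/-- Unit propagation, started with the single literal `x a = b`. -/
def propagate (Φ : TwoSatMod G n m) (a : Fin n) (b : Bool) : Partial n :=
  (sweep Φ m)^[n + 1] (Function.update (fun _ => none) a (some b), false)

/-- The partial assignment is closed under unit propagation. -/
def Closed (Φ : TwoSatMod G n m) (p : Fin n → Option Bool) : Prop :=
  ∀ k, (p (Φ.clause k).1.1 = some (!(Φ.clause k).1.2) →
      p (Φ.clause k).2.1 = some (Φ.clause k).2.2) ∧
    (p (Φ.clause k).2.1 = some (!(Φ.clause k).2.2) →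
      p (Φ.clause k).1.1 = some (Φ.clause k).1.2)

theorem clauseStep_induction (Φ : TwoSatMod G n m) {C : Partial n → Prop} {k : ℕ} {s : Partial n}
    (h0 : C s) (h : ∀ l l' s, C s → C (force l l' s)) : C (clauseStep Φ k s) := by
  unfold clauseStep
  split_ifs
  · exact h _ _ _ (h _ _ _ h0)
  · exact h0

theorem sweep_induction (Φ : TwoSatMod G n m) {C : Partial n → Prop} {k : ℕ} {s : Partial n}
    (h0 : C s) (h : ∀ l l' s, C s → C (force l l' s)) : C (sweep Φ k s) := by
  induction k with
  | zero => exact h0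
  | succ k ih => exact clauseStep_induction Φ ih h

theorem clauseStep_eq_or_size_lt (Φ : TwoSatMod G n m) (k : ℕ) (s : Partial n) :
    clauseStep Φ k s = s ∨ s.size < (clauseStep Φ k s).size := by
  unfold clauseStep
  split_ifs with h
  · set l := (Φ.clause ⟨k, h⟩).1
    set l' := (Φ.clause ⟨k, h⟩).2
    rcases force_eq_or_size_lt l l' s with h1 | h1
    · rw [h1]; exact force_eq_or_size_lt l' l s
    · rcases force_eq_or_size_lt l' l (force l l' s) with h2 | h2
      · rw [h2]; exact .inr h1
      · exact .inr (h1.trans h2)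
  · exact .inl rfl

theorem sweep_eq_or_size_lt (Φ : TwoSatMod G n m) (k : ℕ) (s : Partial n) :
    sweep Φ k s = s ∨ s.size < (sweep Φ k s).size := by
  induction k with
  | zero => exact .inl rfl
  | succ k ih =>
    rw [sweep]
    rcases ih with h1 | h1
    · rw [h1]; exact clauseStep_eq_or_size_lt Φ k s
    · rcases clauseStep_eq_or_size_lt Φ k (sweep Φ k s) with h2 | h2
      · rw [h2]; exact .inr h1
      · exact .inr (h1.trans h2)

/-- Sizes never decrease during a sweep, so a change at one clause cannot be undone by a later one.
-/
theorem clauseStep_eq_of_sweep_eq (Φ : TwoSatMod G n m) {k : ℕ} {s : Partial n}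
    (h : sweep Φ k s = s) {i : ℕ} (hi : i < k) : clauseStep Φ i s = s := by
  induction k with
  | zero => omega
  | succ k ih =>
    rw [sweep] at h
    have hk : sweep Φ k s = s := by
      rcases sweep_eq_or_size_lt Φ k s with h1 | h1
      · exact h1
      · rcases clauseStep_eq_or_size_lt Φ k (sweep Φ k s) with h2 | h2
        · rwa [h2] at h
        · rw [h] at h2; omega
    rcases Nat.lt_succ_iff_lt_or_eq.1 hi with h' | rfl
    · exact ih hk h'
    · rwa [hk] at h

theorem closed_of_sweep_eq (Φ : TwoSatMod G n m) {s : Partial n} (hs : s.2 = false)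
    (h : sweep Φ m s = s) : Φ.Closed s.1 := by
  rintro ⟨k, hk⟩
  have hc := clauseStep_eq_of_sweep_eq Φ h hk
  rw [clauseStep, dif_pos hk] at hc
  set l := (Φ.clause ⟨k, hk⟩).1
  set l' := (Φ.clause ⟨k, hk⟩).2
  have h1 : force l l' s = s := by
    rcases force_eq_or_size_lt l l' s with h1 | h1
    · exact h1
    · rcases force_eq_or_size_lt l' l (force l l' s) with h2 | h2
      · rwa [h2] at hc
      · rw [hc] at h2; omega
  rw [h1] at hc
  exact ⟨force_isFixed hs h1, force_isFixed hs hc⟩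

/-- The assignment satisfies all clauses. -/
def Satisfies (Φ : TwoSatMod G n m) (z : Fin n → Bool) : Prop :=
  ∀ k, (Φ.clause k).1.IsTrue z ∨ (Φ.clause k).2.IsTrue z

theorem propagate_below {Φ : TwoSatMod G n m} {z : Fin n → Bool} (hz : Φ.Satisfies z) (a : Fin n) :
    (Φ.propagate a (z a)).Below z := by
  unfold propagate
  have h0 : Partial.Below ((Function.update (fun _ => none) a (some (z a)), false) : Partial n) z := by
    refine ⟨rfl, fun v b hv => ?_⟩
    by_cases hva : v = a
    · subst hva; simpa using hv
    · simp [hva] at hv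
  have hclause : ∀ k s, Partial.Below s z → (clauseStep Φ k s).Below z := by
    intro k s hs
    unfold clauseStep
    split_ifs with h
    · exact (hs.force (hz ⟨k, h⟩)).force (hz ⟨k, h⟩).symm
    · exact hs
  have hsweep : ∀ k s, Partial.Below s z → (sweep Φ k s).Below z := by
    intro k s hs
    induction k with
    | zero => exact hs
    | succ k ih => exact hclause k _ ih
  generalize n + 1 = r
  induction r with
  | zero => exact h0
  | succ r ih => rw [Function.iterate_succ_apply']; exact hsweep m _ ih

theorem propagate_self (Φ : TwoSatMod G n m) (a : Fin n) (b : Bool) :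
    (Φ.propagate a b).1 a = some b := by
  unfold propagate
  generalize n + 1 = r
  induction r with
  | zero => simp
  | succ r ih =>
    rw [Function.iterate_succ_apply']
    exact sweep_induction Φ (C := fun s => s.1 a = some b) ih fun _ _ _ => force_extends

/-- The size is at most `n + 1`, so the `n + 1` sweeps of `propagate` reach a fixed point. -/
theorem propagate_closed {Φ : TwoSatMod G n m} {a : Fin n} {b : Bool}
    (h : (Φ.propagate a b).2 = false) : Φ.Closed (Φ.propagate a b).1 :=
  closed_of_sweep_eq Φ h
    (Function.iterate_isFixedPt_of_measure _ Partial.size _ (sweep_eq_or_size_lt Φ m)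
      Partial.size_le _)

/-! ## Overriding one partial assignment by another -/

/-- The partial assignment `p` where it is defined, and `q` elsewhere. -/
def override (p q : Fin n → Option Bool) : Fin n → Option Bool := fun v => (p v).or (q v)

/-- The critical case is a clause whose first literal is false by `q` and unassigned by `p`. Then
`q` makes the second literal true, and `p` cannot make it false, since `p` would then force the
first one. This uses closedness of `p` in the opposite direction. -/
theorem Closed.override {Φ : TwoSatMod G n m} {p q : Fin n → Option Bool} (hp : Φ.Closed p)
    (hq : Φ.Closed q) : Φ.Closed (override p q) := by
  have key : ∀ l l' : Literal n, (p l.1 = some (!l.2) → p l'.1 = some l'.2) →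
      (p l'.1 = some (!l'.2) → p l.1 = some l.2) → (q l.1 = some (!l.2) → q l'.1 = some l'.2) →
      TwoSatMod.override p q l.1 = some (!l.2) → TwoSatMod.override p q l'.1 = some l'.2 := by
    rintro ⟨v, b⟩ ⟨v', b'⟩ h1 h2 h3
    simp only [TwoSatMod.override] at *
    rcases hv : p v with _ | c <;> rcases hv' : p v' with _ | c' <;>
      simp only [hv, hv'] at h1 h2 h3 ⊢ <;> cases b <;> cases b' <;> simp_all
  exact fun k => ⟨key _ _ (hp k).1 (hp k).2 (hq k).1, key _ _ (hp k).2 (hp k).1 (hq k).2⟩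

/-- The total assignment obtained from `x` by overriding it by `p`. -/
def extend (p : Fin n → Option Bool) (x : Fin n → Bool) : Fin n → Bool := fun v => (p v).getD (x v)

theorem override_some (p : Fin n → Option Bool) (x : Fin n → Bool) :
    override p (fun v => some (x v)) = fun v => some (extend p x v) := by
  funext v
  unfold override extend
  cases p v <;> rfl

/-- Through this, overriding a total satisfying assignment is a case of `Closed.override`. -/
theorem closed_some_iff {Φ : TwoSatMod G n m} {x : Fin n → Bool} :
    Φ.Closed (fun v => some (x v)) ↔ Φ.Satisfies x := by
  refine forall_congr' fun k => ?_
  simp only [Literal.IsTrue, Option.some.injEq]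
  cases x (Φ.clause k).1.1 <;> cases x (Φ.clause k).2.1 <;> cases (Φ.clause k).1.2 <;>
    cases (Φ.clause k).2.2 <;> simp

theorem Satisfies.extend {Φ : TwoSatMod G n m} {p : Fin n → Option Bool} {x : Fin n → Bool}
    (hx : Φ.Satisfies x) (hp : Φ.Closed p) : Φ.Satisfies (extend p x) := by
  rw [← closed_some_iff] at hx ⊢
  rw [← override_some]
  exact hp.override hx

/-! ## Solutions generated by few literals -/

/-- Among the assignments obtained from `x` by overriding it at most `k` times by the consequences
of a literal false under `y`, there is one that satisfies the global constraint. -/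
def Hits [AddCommGroup G] (Φ : TwoSatMod G n m) (y : Fin n → Bool) : ℕ → (Fin n → Bool) → Prop
  | 0, x => ∑ j, Φ.weight j (x j) ∈ Φ.target
  | k + 1, x => ∑ j, Φ.weight j (x j) ∈ Φ.target ∨
      ∃ a, (Φ.propagate a (!y a)).2 = false ∧ Φ.Hits y k (extend (Φ.propagate a (!y a)).1 x)

/-- One literal, being true, forces the other by a single clause. -/
def Implies (Φ : TwoSatMod G n m) (l l' : Literal n) : Prop :=
  ∃ k, Φ.clause k = ((l.1, !l.2), l') ∨ Φ.clause k = (l', (l.1, !l.2))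

theorem Closed.of_reflTransGen {Φ : TwoSatMod G n m} {p : Fin n → Option Bool} (hp : Φ.Closed p)
    {l l' : Literal n} (h : Relation.ReflTransGen Φ.Implies l l') (hl : p l.1 = some l.2) :
    p l'.1 = some l'.2 := by
  induction h with
  | refl => exact hl
  | tail _ h ih =>
    obtain ⟨k, hk | hk⟩ := h
    · have := (hp k).1
      rw [hk] at this
      exact this (by simpa using ih)
    · have := (hp k).2
      rw [hk] at this
      exact this (by simpa using ih)

/-- Invariant: wherever `x` differs from `z`, the value of `z` is implied by a literal of the
remaining list. Overriding by the consequences of the first literal introduces only values of `z`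
and settles all variables reached from it, so the rest of the list serves for the remaining
differences. -/
theorem hits_of_generated [AddCommGroup G] {Φ : TwoSatMod G n m} {y z : Fin n → Bool}
    (hz : Φ.IsSolution z) (k : ℕ) (L : List (Fin n)) (hL : ∀ a ∈ L, z a ≠ y a)
    (hk : L.length ≤ k) (x : Fin n → Bool)
    (hx : ∀ v, x v ≠ z v →
      ∃ a ∈ L, Relation.ReflTransGen Φ.Implies (a, z a) (v, z v)) : Φ.Hits y k x := by
  induction L generalizing k x with
  | nil =>
    have : x = z := by
      funext v
      by_contra h
      simpa using hx v h
    subst this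
    cases k with
    | zero => exact hz.2
    | succ k => exact .inl hz.2
  | cons a L ih =>
    cases k with
    | zero => simp at hk
    | succ k =>
      have hya : (!y a) = z a := by
        have := hL a (by simp)
        revert this
        cases y a <;> cases z a <;> simp
      have hb := propagate_below hz.1 a
      refine .inr ⟨a, by rw [hya]; exact hb.1, ?_⟩
      rw [hya]
      refine ih k (fun a' ha' => hL a' (by simp [ha'])) (by simpa using hk) _ fun v hv => ?_
      cases hp : (Φ.propagate a (z a)).1 v with
      | some b =>
        have := hb.2 v b hp
        simp [extend, hp, this] at hv
      | none =>
        simp only [extend, hp, Option.getD_none] at hv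
        obtain ⟨a', ha', hr⟩ := hx v hv
        rcases List.mem_cons.1 ha' with rfl | ha'
        · have := (propagate_closed hb.1).of_reflTransGen hr (propagate_self Φ _ _)
          simp [hp] at this
        · exact ⟨a', ha', hr⟩

/-- Resetting a solution to another one at all variables where the two differ and whose value
implies one of a given set of literals gives a solution. -/
theorem Satisfies.reset {Φ : TwoSatMod G n m} {y z : Fin n → Bool} (hy : Φ.Satisfies y)
    (hz : Φ.Satisfies z) (B : Finset (Fin n)) (D : Finset (Fin n))
    (hD : ∀ v, v ∈ D ↔ z v ≠ y v ∧
      ∃ a ∈ B, Relation.ReflTransGen Φ.Implies (v, z v) (a, z a)) :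
    Φ.Satisfies (fun v => if v ∈ D then y v else z v) := by
  -- Only clauses with one variable in `D` and one outside can break. If both literals became false,
  -- then `y` and `z` would differ at the outer variable, and its value under `z` would imply, by
  -- this very clause, the value under `z` of the inner one. That places the outer variable in `D`.
  have key : ∀ l l' : Literal n, (∃ k, Φ.clause k = (l, l') ∨ Φ.clause k = (l', l)) →
      (l.IsTrue y ∨ l'.IsTrue y) → l.1 ∈ D → l'.1 ∉ D → y l.1 = l.2 ∨ z l'.1 = l'.2 := by
    rintro ⟨v, b⟩ ⟨v', b'⟩ ⟨k, hk⟩ h1 h2 h3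
    by_contra! hcon
    obtain ⟨c1, c2⟩ := hcon
    simp only [Literal.IsTrue] at *
    have hy' : y v' = b' := h1.resolve_left c1
    have hzv : z v = b := by
      have := ((hD v).1 h2).1
      revert this c1
      cases z v <;> cases y v <;> cases b <;> simp
    have hzv' : (!z v') = b' := by
      revert c2
      cases z v' <;> cases b' <;> simp
    obtain ⟨hne, a, ha, hr⟩ := (hD v).1 h2
    refine h3 ((hD v').2 ⟨by rw [hy']; exact c2, a, ha, .head ⟨k, ?_⟩ hr⟩)
    rw [hzv, hzv']
    exact hk.symm
  intro k
  simp only [Literal.IsTrue]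
  by_cases h1 : (Φ.clause k).1.1 ∈ D <;> by_cases h2 : (Φ.clause k).2.1 ∈ D <;>
    simp only [h1, h2, if_true, if_false]
  · exact hy k
  · exact key _ _ ⟨k, .inl rfl⟩ (hy k) h1 h2
  · exact (key _ _ ⟨k, .inr rfl⟩ (hy k).symm h2 h1).symm
  · exact hz k

/-- Induction on the distance from `y`: either few literals generate `z`, or an exchange yields a
solution closer to `y`. It is `y` that must be hit from, not `z`, so replacing `z` loses nothing. -/
theorem hits_of_isSolution [AddCommGroup G] [Finite G] {Φ : TwoSatMod G n m} {y z : Fin n → Bool}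
    (hy : Φ.Satisfies y) (hz : Φ.IsSolution z) : Φ.Hits y (Nat.card G - 1) y := by
  classical
  induction hd : (Finset.univ.filter fun v => z v ≠ y v).card using Nat.strong_induction_on
    generalizing z with
  | _ d ih =>
  set T := Finset.univ.filter fun v => z v ≠ y v with hT
  have hmT : ∀ v, v ∈ T ↔ z v ≠ y v := by simp [hT]
  let R : Fin n → Fin n → Prop := fun v w => Relation.ReflTransGen Φ.Implies (v, z v) (w, z w)
  have hRt : ∀ {u v w}, R u v → R v w → R u w := fun h h' => h.trans h'
  obtain ⟨A, ⟨hAT, hAgen⟩, hAmin⟩ := Finset.exists_min_image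
    (T.powerset.filter fun A => ∀ v ∈ T, ∃ a ∈ A, R a v) Finset.card
    ⟨T, by simpa using fun v hv => ⟨v, hv, .refl⟩⟩ |>.imp fun A h => by
      simpa only [Finset.mem_filter, Finset.mem_powerset] using h
  -- By minimality: an element reached from another one could be dropped.
  have hanti : ∀ a ∈ A, ∀ a' ∈ A, R a a' → a = a' := by
    intro a ha a' ha' hr
    by_contra hne
    have := hAmin (A.erase a') ⟨(Finset.erase_subset _ _).trans hAT, fun v hv => by
      obtain ⟨b, hb, hbv⟩ := hAgen v hv
      by_cases hba : b = a'
      · subst hba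
        exact ⟨a, Finset.mem_erase.2 ⟨hne, ha⟩, hRt hr hbv⟩
      · exact ⟨b, Finset.mem_erase.2 ⟨hba, hb⟩, hbv⟩⟩
    have := Finset.card_erase_lt_of_mem ha'
    omega
  by_cases hcard : A.card ≤ Nat.card G - 1
  · refine hits_of_generated hz _ A.toList (fun a ha => ?_) (by simpa using hcard) _ fun v hv => ?_
    · exact (hmT a).1 (hAT (by simpa using ha))
    · obtain ⟨a, ha, hr⟩ := hAgen v ((hmT v).2 hv.symm)
      exact ⟨a, by simpa using ha, hr⟩
  -- `C a` collects the predecessors of `a`, not its consequences: it is sets closed under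
  -- predecessors that can be reset.
  · let C : Fin n → Finset (Fin n) := fun a => T.filter fun v => R v a
    obtain ⟨B, hBA, ⟨b, hb⟩, hB⟩ := exists_nonempty_subset_sum_eq_zero A
      (fun a => ∑ v ∈ C a, (Φ.weight v (z v) - Φ.weight v (y v))) (by omega)
    let D := B.biUnion C
    -- A common predecessor of `a` and `a'` is itself reached from some `c ∈ A`, which then equals
    -- both.
    have hdisj : ∀ a ∈ B, ∀ a' ∈ B, a ≠ a' → Disjoint (C a) (C a') := by
      intro a ha a' ha' hne
      rw [Finset.disjoint_left]
      intro v hv hv'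
      obtain ⟨hvT, hva⟩ := Finset.mem_filter.1 hv
      have hva' := (Finset.mem_filter.1 hv').2
      obtain ⟨c, hc, hcv⟩ := hAgen v hvT
      exact hne ((hanti c hc a (hBA ha) (hRt hcv hva)).symm.trans
        (hanti c hc a' (hBA ha') (hRt hcv hva')))
    have hmD : ∀ v, v ∈ D ↔ z v ≠ y v ∧ ∃ a ∈ B, R v a := by
      intro v
      simp only [D, C, Finset.mem_biUnion, Finset.mem_filter, hmT]
      tauto
    have hsat := hy.reset hz.1 B D hmD
    set z' : Fin n → Bool := fun v => if v ∈ D then y v else z v with hz'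
    have hsum : ∑ v, Φ.weight v (z' v) = ∑ v, Φ.weight v (z v) := by
      rw [← Finset.sum_biUnion hdisj] at hB
      have h1 : ∀ v, Φ.weight v (z v) - Φ.weight v (z' v) =
          if v ∈ D then Φ.weight v (z v) - Φ.weight v (y v) else 0 := by
        intro v
        by_cases hv : v ∈ D <;> simp [hz', hv]
      have h2 : ∑ v, (Φ.weight v (z v) - Φ.weight v (z' v)) = 0 := by
        rw [Finset.sum_congr rfl fun v _ => h1 v]
        simpa using hB
      rw [Finset.sum_sub_distrib, sub_eq_zero] at h2
      exact h2.symm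
    -- The distance drops strictly because `b ∈ B` lies in `D` by reflexivity.
    refine ih _ ?_ (z := z') ⟨hsat, by rw [hsum]; exact hz.2⟩ rfl
    rw [← hd]
    refine Finset.card_lt_card ((Finset.ssubset_iff_of_subset fun v hv => ?_).2 ⟨b, ?_, ?_⟩)
    · simp only [Finset.mem_filter, Finset.mem_univ, true_and, hz'] at hv
      rw [hmT]
      by_cases hvD : v ∈ D
      · simp [hvD] at hv
      · simpa [hvD] using hv
    · exact hAT (hBA hb)
    · have : b ∈ D := (hmD b).2 ⟨(hmT b).1 (hAT (hBA hb)), b, hb, .refl⟩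
      simp [hz', this]

end TwoSatMod

namespace RAM

/-! ## Time-bounded total correctness -/

/-- The program `P`, started in `s`, halts within `T` steps, in a state that satisfies `Q`. -/
def Runs (P : Program) (s : State) (T : ℕ) (Q : State → Prop) : Prop :=
  ∃ s' t, Exec P s s' t ∧ t ≤ T ∧ Q s'

/-- The program assigns to the scalar register `x` somewhere. -/
def Program.WritesScalar : Program → ℕ → Prop
  | .skip, _ => False
  | .setScalar y _, x => x = y
  | .setCell _ _ _, _ => False
  | .seq P Q, x => P.WritesScalar x ∨ Q.WritesScalar x
  | .ifThenElse _ P Q, x => P.WritesScalar x ∨ Q.WritesScalar x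
  | .whileDo _ P, x => P.WritesScalar x

/-- The program assigns to a cell of the array `a` somewhere. -/
def Program.WritesArray : Program → ℕ → Prop
  | .skip, _ => False
  | .setScalar _ _, _ => False
  | .setCell b _ _, a => a = b
  | .seq P Q, a => P.WritesArray a ∨ Q.WritesArray a
  | .ifThenElse _ P Q, a => P.WritesArray a ∨ Q.WritesArray a
  | .whileDo _ P, a => P.WritesArray a

/-- The states differ at most where the program writes. -/
def Frame (P : Program) (s s' : State) : Prop :=
  (∀ x, ¬ P.WritesScalar x → s'.scalar x = s.scalar x) ∧
    ∀ a, ¬ P.WritesArray a → s'.array a = s.array a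

theorem Frame.refl (P : Program) (s : State) : Frame P s s := ⟨fun _ _ => rfl, fun _ _ => rfl⟩

theorem Frame.trans {P : Program} {s s' s'' : State} (h : Frame P s s') (h' : Frame P s' s'') :
    Frame P s s'' :=
  ⟨fun x hx => (h'.1 x hx).trans (h.1 x hx), fun a ha => (h'.2 a ha).trans (h.2 a ha)⟩

theorem Frame.mono {P Q : Program} {s s' : State} (h : Frame P s s')
    (hs : ∀ x, P.WritesScalar x → Q.WritesScalar x) (ha : ∀ a, P.WritesArray a → Q.WritesArray a) :
    Frame Q s s' :=
  ⟨fun x hx => h.1 x (mt (hs x) hx), fun a hx => h.2 a (mt (ha a) hx)⟩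

theorem Exec.frame {P : Program} {s s' : State} {t : ℕ} (h : Exec P s s' t) : Frame P s s' := by
  induction h with
  | skip s => exact Frame.refl _ _
  | setScalar x e s =>
    exact ⟨fun y hy => if_neg hy, fun _ _ => rfl⟩
  | setCell a i e s =>
    exact ⟨fun _ _ => rfl, fun b hb => funext fun j => if_neg fun h => hb h.1⟩
  | seq _ _ ih ih' =>
    exact Frame.trans (ih.mono (fun _ => Or.inl) fun _ => Or.inl)
      (ih'.mono (fun _ => Or.inr) fun _ => Or.inr)
  | ifTrue _ _ ih => exact ih.mono (fun _ => Or.inl) fun _ => Or.inl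
  | ifFalse _ _ ih => exact ih.mono (fun _ => Or.inr) fun _ => Or.inr
  | whileTrue _ _ _ ih ih' => exact Frame.trans (P := .whileDo _ _) (ih.mono (fun _ => id) fun _ => id) ih'
  | whileFalse _ => exact Frame.refl _ _

namespace Runs

variable {P Q : Program} {s : State} {T T' : ℕ} {A B : State → Prop}

theorem mono (h : Runs P s T A) (hT : T ≤ T') (hA : ∀ s', A s' → B s') : Runs P s T' B := by
  obtain ⟨s', t, he, ht, ha⟩ := h
  exact ⟨s', t, he, ht.trans hT, hA s' ha⟩

theorem le (h : Runs P s T A) (hT : T ≤ T') : Runs P s T' A := h.mono hT fun _ => id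

theorem imp (h : Runs P s T A) (hA : ∀ s', Frame P s s' → A s' → B s') : Runs P s T B := by
  obtain ⟨s', t, he, ht, ha⟩ := h
  exact ⟨s', t, he, ht, hA s' he.frame ha⟩

theorem skip (h : A s) : Runs .skip s 1 A := ⟨s, 1, .skip s, le_rfl, h⟩

theorem setScalar {x : ℕ} {e : Expr} (h : A (s.setScalar x (e.eval s))) :
    Runs (.setScalar x e) s (e.cost + 1) A :=
  ⟨_, _, .setScalar x e s, le_rfl, h⟩

theorem setCell {a : ℕ} {i e : Expr} (h : A (s.setCell a (i.eval s) (e.eval s))) :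
    Runs (.setCell a i e) s (i.cost + e.cost + 1) A :=
  ⟨_, _, .setCell a i e s, le_rfl, h⟩

theorem seq (h : Runs P s T B) (h' : ∀ s', Frame P s s' → B s' → Runs Q s' T' A) :
    Runs (.seq P Q) s (T + T') A := by
  obtain ⟨s', t, he, ht, hb⟩ := h
  obtain ⟨s'', t', he', ht', ha⟩ := h' s' he.frame hb
  exact ⟨s'', t + t', .seq he he', by omega, ha⟩

theorem ifThenElse {b : Test} (h : b.Holds s → Runs P s T A) (h' : ¬ b.Holds s → Runs Q s T A) :
    Runs (.ifThenElse b P Q) s (b.cost + T) A := by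
  by_cases hb : b.Holds s
  · obtain ⟨s', t, he, ht, ha⟩ := h hb
    exact ⟨s', _, .ifTrue hb he, by omega, ha⟩
  · obtain ⟨s', t, he, ht, ha⟩ := h' hb
    exact ⟨s', _, .ifFalse hb he, by omega, ha⟩

end Runs

/-! ## Counting loops and unrolled loops -/

/-- Run the body with the register `i` equal to `0`, …, up to the value of `b`, exclusive. -/
def forTo (i : ℕ) (b : Expr) (P : Program) : Program :=
  .seq (.setScalar i (.const 0))
    (.whileDo (.lt (.scalar i) b) (.seq P (.setScalar i (.succ (.scalar i)))))

/-- Each round costs the body, `b.cost + 2` for the test and 3 for the increment. The frame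
hypotheses supply everything the loop never writes, so `Inv` need only mention what changes. -/
theorem Runs.forTo {i N T : ℕ} {b : Expr} {P : Program} {s₀ : State} {A : State → Prop}
    (Inv : ℕ → State → Prop)
    (h0 : Inv 0 (s₀.setScalar i 0))
    (hb : ∀ s, Frame (forTo i b P) s₀ s → b.eval s = N)
    (hP : ∀ k < N, ∀ s, Frame (RAM.forTo i b P) s₀ s → s.scalar i = k → Inv k s →
      Runs P s T fun s' => s'.scalar i = k ∧ Inv (k + 1) (s'.setScalar i (k + 1)))
    (hA : ∀ s, Frame (RAM.forTo i b P) s₀ s → Inv N s → A s) :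
    Runs (RAM.forTo i b P) s₀ (N * (T + b.cost + 5) + b.cost + 4) A := by
  have key : ∀ d k s, k + d = N → Frame (RAM.forTo i b P) s₀ s → s.scalar i = k → Inv k s →
      Runs (.whileDo (.lt (.scalar i) b) (.seq P (.setScalar i (.succ (.scalar i))))) s
        (d * (T + b.cost + 5) + b.cost + 2) A := by
    intro d
    induction d with
    | zero =>
      intro k s hk hF hi hI
      obtain rfl : k = N := hk
      refine ⟨s, _, .whileFalse ?_, ?_, hA s hF hI⟩
      · simp [Test.Holds, Expr.eval, hb s hF, hi]
      · simp [Test.cost, Expr.cost]; omega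
    | succ d ih =>
      intro k s hk hF hi hI
      obtain ⟨s', t, he, ht, hi', hI'⟩ := hP k (by omega) s hF hi hI
      have he' := Exec.seq he (Exec.setScalar i (.succ (.scalar i)) s')
      have hF' : Frame (RAM.forTo i b P) s (s'.setScalar i (k + 1)) := by
        have := he'.frame
        simp only [Expr.eval, hi'] at this
        exact this.mono (fun _ => Or.inr) fun _ => Or.inr
      obtain ⟨s'', t', he'', ht', ha⟩ :=
        ih (k + 1) (s'.setScalar i (k + 1)) (by omega) (hF.trans hF') (by simp [State.setScalar]) hI'
      refine ⟨s'', _, .whileTrue ?_ he' (by simpa [Expr.eval, hi'] using he''), ?_, ha⟩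
      · simp only [Test.Holds, Expr.eval, hb s hF, hi]; omega
      · simp only [Test.cost, Expr.cost]
        have : (d + 1) * (T + b.cost + 5) = d * (T + b.cost + 5) + (T + b.cost + 5) := by ring
        omega
  have hF : Frame (RAM.forTo i b P) s₀ (s₀.setScalar i 0) :=
    (Exec.setScalar i (.const 0) s₀).frame.mono (fun _ => Or.inl) fun _ => Or.inl
  obtain ⟨s', t, he, ht, ha⟩ := key N 0 _ (by omega) hF (by simp [State.setScalar]) h0
  refine ⟨s', _, .seq (.setScalar i (.const 0) s₀) he, ?_, ha⟩
  simp only [Expr.cost]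
  omega

/-- The programs `f 0`, …, `f (k - 1)`, one after the other. -/
def unroll (f : ℕ → Program) : ℕ → Program
  | 0 => .skip
  | k + 1 => .seq (unroll f k) (f k)

/-- Used for loops over `G`, whose size is fixed with the program: the index becomes a constant of
the program text. -/
theorem Runs.unroll {f : ℕ → Program} {N T : ℕ} {s₀ : State} {A : State → Prop}
    (Inv : ℕ → State → Prop) (h0 : Inv 0 s₀)
    (hP : ∀ k < N, ∀ s, Frame (unroll f N) s₀ s → Inv k s → Runs (f k) s T (Inv (k + 1)))
    (hA : ∀ s, Inv N s → A s) : Runs (unroll f N) s₀ (N * T + 1) A := by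
  refine Runs.mono (A := Inv N) ?_ le_rfl hA
  clear hA
  induction N with
  | zero => exact (Runs.skip h0).le (by omega)
  | succ N ih =>
    refine ((ih fun k hk s hF hI => hP k (by omega) s
      (hF.mono (fun _ => Or.inl) fun _ => Or.inl) hI).seq fun s hF hI => hP N (by omega) s
      (hF.mono (fun _ => Or.inl) fun _ => Or.inl) hI).le ?_
    have : (N + 1) * T = N * T + T := by ring
    omega

theorem writesScalar_unroll {f : ℕ → Program} {N x : ℕ} :
    (unroll f N).WritesScalar x ↔ ∃ k < N, (f k).WritesScalar x := by
  induction N with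
  | zero => simp [unroll, Program.WritesScalar]
  | succ N ih =>
    simp only [unroll, Program.WritesScalar, ih, Nat.lt_succ_iff_lt_or_eq, or_and_right, exists_or,
      exists_eq_left]

theorem writesArray_unroll {f : ℕ → Program} {N a : ℕ} :
    (unroll f N).WritesArray a ↔ ∃ k < N, (f k).WritesArray a := by
  induction N with
  | zero => simp [unroll, Program.WritesArray]
  | succ N ih =>
    simp only [unroll, Program.WritesArray, ih, Nat.lt_succ_iff_lt_or_eq, or_and_right, exists_or,
      exists_eq_left]

end RAM

/-! ### Effect of writes, and addition of constants -/

namespace RAM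

@[simp] theorem State.scalar_setScalar (s : State) (x v y : ℕ) :
    (s.setScalar x v).scalar y = if y = x then v else s.scalar y := rfl

@[simp] theorem State.array_setScalar (s : State) (x v : ℕ) : (s.setScalar x v).array = s.array := rfl

@[simp] theorem State.scalar_setCell (s : State) (a i v : ℕ) :
    (s.setCell a i v).scalar = s.scalar := rfl

@[simp] theorem State.array_setCell (s : State) (a i v b j : ℕ) :
    (s.setCell a i v).array b j = if b = a ∧ j = i then v else s.array b j := rfl

/-- The expression `e + k`. -/
def Expr.add (e : Expr) : ℕ → Expr
  | 0 => e
  | k + 1 => .succ (e.add k)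

@[simp] theorem Expr.eval_add (e : Expr) (k : ℕ) (s : State) : (e.add k).eval s = e.eval s + k := by
  induction k with
  | zero => rfl
  | succ k ih => simp [Expr.add, Expr.eval, ih, Nat.add_assoc]

@[simp] theorem Expr.cost_add (e : Expr) (k : ℕ) : (e.add k).cost = e.cost + k := by
  induction k with
  | zero => rfl
  | succ k ih => simp [Expr.add, Expr.cost, ih, Nat.add_assoc]

end RAM

namespace TwoSatMod

open RAM

variable {G : Type u} {n m : ℕ}

/-! ## Unit propagation as a program

Scalar registers: 2 reports a conflict, 3, 4, 5 are loop counters, 11 holds the value of the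
literal to start with. Array 8 holds the partial assignment. -/

/-- The number representing a value of a partial assignment. -/
def code : Option Bool → ℕ
  | none => 0
  | some b => b.toNat + 1

/-- The array `f` represents the partial assignment `p`. -/
def Encodes (f : ℕ → ℕ) (p : Fin n → Option Bool) : Prop := ∀ v : Fin n, f v = code (p v)

/-- The memory holds the partial assignment and the conflict flag. -/
def Partial.Stored (q : Partial n) (s : State) : Prop :=
  Encodes (s.array 8) q.1 ∧ s.scalar 2 = q.2.toNat

/-- The memory still holds the instance. -/
structure Loaded (e : G ≃ Fin (Nat.card G)) (Φ : TwoSatMod G n m) (s : State) : Prop where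
  vars : s.scalar 0 = n
  clauses : s.scalar 1 = m
  input : ∀ a < 7, s.array a = (Φ.input e).array a

/-- The program does not overwrite the instance. -/
def KeepsInput (P : Program) : Prop :=
  (∀ x < 2, ¬ P.WritesScalar x) ∧ ∀ a < 7, ¬ P.WritesArray a

theorem Loaded.frame {e : G ≃ Fin (Nat.card G)} {Φ : TwoSatMod G n m} {s s' : State} {P : Program}
    (h : Loaded e Φ s) (hF : Frame P s s') (hP : KeepsInput P) : Loaded e Φ s' :=
  ⟨(hF.1 0 (hP.1 0 (by omega))).trans h.vars, (hF.1 1 (hP.1 1 (by omega))).trans h.clauses,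
    fun a ha => (hF.2 a (hP.2 a ha)).trans (h.input a ha)⟩

/-- If the literal given by the arrays `a` and `b` is false, make the literal given by the arrays
`a'` and `b'` true, or report a conflict. -/
def forceProgram (a b a' b' : ℕ) : Program :=
  .ifThenElse (.eq (.cell 8 (.cell a (.scalar 3))) (.const 0)) .skip <|
  .ifThenElse (.eq (.cell 8 (.cell a (.scalar 3))) (.succ (.cell b (.scalar 3)))) .skip <|
  .ifThenElse (.eq (.cell 8 (.cell a' (.scalar 3))) (.const 0))
    (.setCell 8 (.cell a' (.scalar 3)) (.succ (.cell b' (.scalar 3)))) <|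
  .ifThenElse (.eq (.cell 8 (.cell a' (.scalar 3))) (.succ (.cell b' (.scalar 3)))) .skip
    (.setScalar 2 (.const 1))

/-- Codes are 0, 1, 2 for unassigned, false, true. A literal of sign `c` is thus false exactly if
the code of its variable is neither 0 nor `c.toNat + 1`. -/
theorem runs_forceProgram {a b a' b' : ℕ} {l l' : Literal n} {q : Partial n} {s : State}
    (ha : s.array a (s.scalar 3) = l.1) (hb : s.array b (s.scalar 3) = l.2.toNat)
    (ha' : s.array a' (s.scalar 3) = l'.1) (hb' : s.array b' (s.scalar 3) = l'.2.toNat)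
    (hq : q.Stored s) : Runs (forceProgram a b a' b') s 30 (force l l' q).Stored := by
  obtain ⟨v, c⟩ := l
  obtain ⟨v', c'⟩ := l'
  have h1 := hq.1 v
  have h2 := hq.1 v'
  refine Runs.le (Runs.ifThenElse (T := 25) (fun h => (Runs.skip ?_).le (by norm_num)) fun h =>
    Runs.ifThenElse (T := 18) (fun h' => (Runs.skip ?_).le (by norm_num)) fun h' =>
    Runs.ifThenElse (T := 13) (fun h'' => (Runs.setCell ?_).le (by simp [Expr.cost])) fun h'' =>
    Runs.ifThenElse (T := 6) (fun h''' => (Runs.skip ?_).le (by norm_num)) fun h''' =>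
    (Runs.setScalar ?_).le (by simp [Expr.cost])) (by simp [Test.cost, Expr.cost])
  all_goals simp only [Test.Holds, Expr.eval, ha, hb, ha', hb', h1, h2] at *
  · have : q.1 v = none := by
      cases hv : q.1 v <;> simp_all [code]
    simpa [force, this] using hq
  · have : q.1 v ≠ some (!c) := by
      intro hv
      cases c <;> simp [hv, code] at h'
    simpa [force, this] using hq
  · have hv : q.1 v = some (!c) := by
      cases hv : q.1 v with
      | none => simp [hv, code] at h
      | some d => cases c <;> cases d <;> simp_all [code]
    have hv' : q.1 v' = none := by
      cases hv : q.1 v' <;> simp_all [code]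
    simp only [force, hv, hv', if_true]
    refine ⟨fun w => ?_, hq.2⟩
    by_cases hw : w = v'
    · subst hw; simp [code]
    · have : (w : ℕ) ≠ v' := fun h => hw (Fin.ext h)
      simpa [hw, this] using hq.1 w
  · have hv' : q.1 v' = some c' := by
      cases hv : q.1 v' with
      | none => simp [hv, code] at h''
      | some d => cases c' <;> cases d <;> simp_all [code]
    have : force (v, c) (v', c') q = q := by simp [force, hv']
    rwa [this]
  · have hv : q.1 v = some (!c) := by
      cases hv : q.1 v with
      | none => simp [hv, code] at h
      | some d => cases c <;> cases d <;> simp_all [code]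
    have hv1 : q.1 v' ≠ none := fun hv => by simp [hv, code] at h''
    have hv2 : q.1 v' ≠ some c' := fun hv => by simp [hv, code] at h'''
    simp only [force, hv, hv1, hv2, if_true, if_false]
    exact ⟨hq.1, by simp⟩

/-- Propagation along all clauses. -/
def sweepProgram : Program :=
  forTo 3 (.scalar 1) (.seq (forceProgram 0 1 2 3) (forceProgram 2 3 0 1))

theorem runs_sweepProgram {e : G ≃ Fin (Nat.card G)} {Φ : TwoSatMod G n m} {q : Partial n}
    {s : State} (hs : Loaded e Φ s) (hq : q.Stored s) :
    Runs sweepProgram s (m * 66 + 5) (Φ.sweep m q).Stored := by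
  have hkeep : KeepsInput sweepProgram := by
    constructor <;> intro x hx <;>
      simp [sweepProgram, forTo, forceProgram, Program.WritesScalar, Program.WritesArray] <;> omega
  have hkeep' : KeepsInput (forceProgram 0 1 2 3) := by
    constructor <;> intro x hx <;>
      simp [forceProgram, Program.WritesScalar, Program.WritesArray] <;> omega
  refine Runs.le (Runs.forTo (N := m) (T := 60) (fun k => (Φ.sweep k q).Stored) ?_ ?_ ?_ ?_)
    (by simp [Expr.cost])
  · exact ⟨hq.1, by simpa [sweep] using hq.2⟩
  · exact fun s hF => (hs.frame hF hkeep).clauses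
  · intro k hk s hF hi hI
    have hs := hs.frame hF hkeep
    have hcell : ∀ s', Loaded e Φ s' → s'.scalar 3 = k →
        s'.array 0 (s'.scalar 3) = (Φ.clause ⟨k, hk⟩).1.1 ∧
        s'.array 1 (s'.scalar 3) = (Φ.clause ⟨k, hk⟩).1.2.toNat ∧
        s'.array 2 (s'.scalar 3) = (Φ.clause ⟨k, hk⟩).2.1 ∧
        s'.array 3 (s'.scalar 3) = (Φ.clause ⟨k, hk⟩).2.2.toNat := by
      intro s' hs' h3
      rw [hs'.input 0 (by omega), hs'.input 1 (by omega), hs'.input 2 (by omega),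
        hs'.input 3 (by omega), h3]
      simp [TwoSatMod.input, hk]
    obtain ⟨h0, h1, h2, h3⟩ := hcell s hs hi
    refine Runs.le ((runs_forceProgram h0 h1 h2 h3 hI).seq (T' := 30) fun s' hF' hI' => ?_) le_rfl
    have hi' : s'.scalar 3 = k := by
      rw [hF'.1 3 (by simp [forceProgram, Program.WritesScalar]), hi]
    obtain ⟨h0, h1, h2, h3⟩ := hcell s' (hs.frame hF' hkeep') hi'
    refine (runs_forceProgram h2 h3 h0 h1 hI').imp fun s'' hF'' hI'' => ⟨?_, ?_⟩
    · rw [hF''.1 3 (by simp [forceProgram, Program.WritesScalar]), hi']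
    · rw [sweep, clauseStep, dif_pos hk]
      exact ⟨hI''.1, by simpa using hI''.2⟩
  · exact fun s _ h => h

/-- Unit propagation, started with the literal whose variable is in the register `x` and whose
value is in the register 11. -/
def propagateProgram (x : ℕ) : Program :=
  .seq (forTo 5 (.scalar 0) (.setCell 8 (.scalar 5) (.const 0))) <|
  .seq (.setScalar 2 (.const 0)) <|
  .seq (.setCell 8 (.scalar x) (.scalar 11)) <|
  forTo 4 (.succ (.scalar 0)) sweepProgram

/-- Number of steps sufficient for `propagateProgram`. -/
def propagateCost (n m : ℕ) : ℕ := n * 9 + (n + 1) * (m * 66 + 12) + 16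

theorem keepsInput_propagateProgram (x : ℕ) : KeepsInput (propagateProgram x) := by
  constructor <;> intro x hx <;>
    simp [propagateProgram, sweepProgram, forTo, forceProgram, Program.WritesScalar,
      Program.WritesArray] <;> omega

/-- Registers 2 and 5 are overwritten before the register `x` is read, hence `hx2` and `hx5`.
Register 11 holds the code of `b`. -/
theorem runs_propagateProgram {e : G ≃ Fin (Nat.card G)} {Φ : TwoSatMod G n m} {x : ℕ} {a : Fin n}
    {b : Bool} {s : State} (hs : Loaded e Φ s) (hx2 : x ≠ 2) (hx5 : x ≠ 5)
    (ha : s.scalar x = a) (hb : s.scalar 11 = b.toNat + 1) :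
    Runs (propagateProgram x) s (propagateCost n m) (Φ.propagate a b).Stored := by
  refine Runs.le (Runs.seq (T := n * 9 + 5) (B := fun s => Encodes (n := n) (s.array 8) fun _ => none)
    ?_ fun s₁ hF₁ h₁ =>
    Runs.seq (T := 2) (B := fun s' => s' = s₁.setScalar 2 0) (Runs.setScalar rfl) fun s₂ hF₂ h₂ =>
    Runs.seq (T := 3) (B := fun s' =>
      Partial.Stored ((Function.update (fun _ => none) a (some b), false) : Partial n) s')
      (Runs.setCell ?_) fun s₃ hF₃ h₃ =>
    Runs.forTo (N := n + 1) (T := m * 66 + 5)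
      (fun k => Partial.Stored ((Φ.sweep m)^[k] (Function.update (fun _ => none) a (some b), false)))
      ?_ ?_ ?_ ?_)
      (by simp only [Expr.cost, propagateCost]; ring_nf; omega)
  · refine Runs.le (Runs.forTo (N := n) (T := 3)
      (fun k s => ∀ i < k, s.array 8 i = 0) ?_ ?_ ?_ ?_) (by simp [Expr.cost])
    · simp
    · exact fun s hF => (hF.1 0 (by simp [forTo, Program.WritesScalar])).trans hs.vars
    · intro k hk s hF hi hI
      refine Runs.setCell ⟨by simpa using hi, fun i hik => ?_⟩
      by_cases h : i = k
      · simp [Expr.eval, hi, h]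
      · simpa [Expr.eval, hi, h] using hI i (by omega)
    · exact fun s _ h v => h v v.2
  · have e1 : s₂.scalar x = a := by
      rw [h₂, State.scalar_setScalar, if_neg hx2, hF₁.1 x (by simp [forTo, Program.WritesScalar, hx5]), ha]
    have e2 : s₂.scalar 11 = b.toNat + 1 := by
      rw [h₂, State.scalar_setScalar, if_neg (by norm_num),
        hF₁.1 11 (by simp [forTo, Program.WritesScalar]), hb]
    have h8 : s₂.array 8 = s₁.array 8 := by rw [h₂, State.array_setScalar]
    refine ⟨fun w => ?_, by simp [h₂]⟩
    by_cases hw : w = a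
    · subst hw; simp [Expr.eval, e1, e2, code]
    · have : (w : ℕ) ≠ a := fun h => hw (Fin.ext h)
      simpa [Expr.eval, e1, hw, this, h8] using h₁ w
  · exact ⟨h₃.1, by simpa using h₃.2⟩
  · intro s₄ hF
    have := ((hs.frame hF₁ ?_).frame hF₂ ?_).frame hF₃ ?_ |>.frame hF ?_
    · simp [Expr.eval, this.vars]
    all_goals constructor <;> intro x hx <;>
      simp [sweepProgram, forTo, forceProgram, Program.WritesScalar, Program.WritesArray] <;> omega
  · intro k hk s₄ hF hi hI
    have := ((hs.frame hF₁ ?_).frame hF₂ ?_).frame hF₃ ?_ |>.frame hF ?_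
    · refine (runs_sweepProgram this hI).imp fun s₅ hF' hI' => ⟨?_, ?_⟩
      · rw [hF'.1 4 (by simp [sweepProgram, forTo, forceProgram, Program.WritesScalar]), hi]
      · rw [Function.iterate_succ_apply']
        exact ⟨hI'.1, by simpa using hI'.2⟩
    all_goals constructor <;> intro x hx <;>
      simp [sweepProgram, forTo, forceProgram, Program.WritesScalar, Program.WritesArray] <;> omega
  · exact fun s _ h => h

/-- Override the partial assignment in the array `src` by that in the array 8, writing the result
to the array `dst`. -/
def overrideProgram (src dst : ℕ) : Program :=
  forTo 5 (.scalar 0) <|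
    .ifThenElse (.eq (.cell 8 (.scalar 5)) (.const 0))
      (.setCell dst (.scalar 5) (.cell src (.scalar 5)))
      (.setCell dst (.scalar 5) (.cell 8 (.scalar 5)))

theorem runs_overrideProgram {src dst : ℕ} {p q : Fin n → Option Bool} {s : State}
    (h0 : s.scalar 0 = n) (hdst : 8 ≠ dst) (hp : Encodes (s.array 8) p)
    (hq : Encodes (s.array src) q) :
    Runs (overrideProgram src dst) s (n * 14 + 5)
      fun s' => Encodes (s'.array dst) (override p q) := by
  refine Runs.le (Runs.forTo (N := n) (T := 8)
    -- Stated so as to allow `src = dst`: the source is claimed intact only at the positions not yet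
    -- visited.
    (fun k s => ∀ v : Fin n, (v < k → s.array dst v = code (override p q v)) ∧
      (k ≤ v → s.array src v = code (q v))) ?_ ?_ ?_ ?_) (by simp [Expr.cost])
  · exact fun v => ⟨fun h => absurd h (by omega), fun _ => hq v⟩
  · exact fun s hF => (hF.1 0 (by simp [forTo, Program.WritesScalar])).trans h0
  · intro k hk s' hF hi hI
    have h8 : s'.array 8 = s.array 8 := hF.2 8 (by simp [forTo, Program.WritesArray, hdst])
    have hpk := hp ⟨k, hk⟩
    simp only at hpk
    have step : ∀ c, c = code (override p q ⟨k, hk⟩) → ∀ v : Fin n,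
        (v < k + 1 → (s'.setCell dst k c).array dst v = code (override p q v)) ∧
        (k + 1 ≤ v → (s'.setCell dst k c).array src v = code (q v)) := by
      intro c hc v
      refine ⟨fun hv => ?_, fun hv => ?_⟩
      · by_cases hvk : (v : ℕ) = k
        · obtain rfl : v = ⟨k, hk⟩ := Fin.ext hvk
          simpa using hc
        · simpa [hvk] using (hI v).1 (by omega)
      · have : (v : ℕ) ≠ k := by omega
        simpa [this] using (hI v).2 (by omega)
    refine Runs.le (Runs.ifThenElse (T := 4) (fun h => (Runs.setCell ?_).le (by simp [Expr.cost]))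
      fun h => (Runs.setCell ?_).le (by simp [Expr.cost])) (by simp [Test.cost, Expr.cost])
    all_goals
      simp only [Test.Holds, Expr.eval, hi, h8, hpk] at h ⊢
      refine ⟨hi, step _ ?_⟩
    · have : p ⟨k, hk⟩ = none := by
        cases hv : p ⟨k, hk⟩ <;> simp_all [code]
      simpa [override, this] using (hI ⟨k, hk⟩).2 le_rfl
    · cases hv : p ⟨k, hk⟩ with
      | none => simp [hv, code] at h
      | some b => simp [override, hv]
  · exact fun s _ h v => (h v).1 v.2

end TwoSatMod

namespace TwoSatMod

open RAM

variable {G : Type u} {n m : ℕ}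

/-! ## Summing up weights along pointers

The pair of `j ≤ n` and `a : G` has the address `j * |G| + e a`. Arrays 10 and 11 hold at this
address, for `j < n`, the addresses of `j + 1` and `a + weight j b`, where `b` is false and true,
respectively. Array 12 holds, for `j = n`, whether `a` is in the target set. In this way the sum of
the weights is found in a number of steps that does not depend on `G`. -/

/-- The pointers for evaluating the global constraint. -/
structure Tables [AddCommGroup G] (e : G ≃ Fin (Nat.card G)) (Φ : TwoSatMod G n m) (s : State) :
    Prop where
  left : ∀ (v : Fin n) a, s.array 10 (v * Nat.card G + e a) =
    (v + 1) * Nat.card G + e (a + Φ.weight v false)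
  right : ∀ (v : Fin n) a, s.array 11 (v * Nat.card G + e a) =
    (v + 1) * Nat.card G + e (a + Φ.weight v true)
  goal : ∀ a, s.array 12 (n * Nat.card G + e a) = 1 ↔ a ∈ Φ.target

theorem Tables.frame [AddCommGroup G] {e : G ≃ Fin (Nat.card G)} {Φ : TwoSatMod G n m}
    {s s' : State} {P : Program} (h : Tables e Φ s) (hF : Frame P s s')
    (h0 : ¬ P.WritesArray 10) (h1 : ¬ P.WritesArray 11) (h2 : ¬ P.WritesArray 12) :
    Tables e Φ s' := by
  constructor
  · rw [hF.2 10 h0]; exact h.left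
  · rw [hF.2 11 h1]; exact h.right
  · rw [hF.2 12 h2]; exact h.goal

open Classical in
/-- Addition of numbers of group elements. -/
noncomputable def addNumber [AddCommGroup G] (e : G ≃ Fin (Nat.card G)) (a b : ℕ) : ℕ :=
  if h : a < Nat.card G ∧ b < Nat.card G then e (e.symm ⟨a, h.1⟩ + e.symm ⟨b, h.2⟩) else 0

theorem addNumber_apply [AddCommGroup G] (e : G ≃ Fin (Nat.card G)) (a b : G) :
    addNumber e (e a) (e b) = e (a + b) := by
  simp [addNumber]

/-- Fill one layer of pointers; the register 10 holds the address where the layer starts, and the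
array `src` holds at the value of the register 5 the number of the element to be added. -/
noncomputable def layerProgram [AddCommGroup G] (e : G ≃ Fin (Nat.card G)) (dst src : ℕ) : Program :=
  unroll (fun b => .ifThenElse (.eq (.cell src (.scalar 5)) (.const b))
    (unroll (fun a => .setCell dst (.add (.scalar 10) a)
      (.add (.scalar 10) (Nat.card G + addNumber e a b))) (Nat.card G)) .skip) (Nat.card G)

theorem addNumber_le [AddCommGroup G] (e : G ≃ Fin (Nat.card G)) (a b : ℕ) :
    addNumber e a b ≤ Nat.card G := by
  unfold addNumber
  split_ifs
  · exact (Fin.is_lt _).le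
  · omega

theorem writesScalar_layerProgram [AddCommGroup G] (e : G ≃ Fin (Nat.card G)) (dst src x : ℕ) :
    ¬ (layerProgram e dst src).WritesScalar x := by
  simp [layerProgram, writesScalar_unroll, Program.WritesScalar]

theorem writesArray_layerProgram [AddCommGroup G] (e : G ≃ Fin (Nat.card G)) {dst src a : ℕ}
    (h : a ≠ dst) : ¬ (layerProgram e dst src).WritesArray a := by
  simp [layerProgram, writesArray_unroll, Program.WritesArray, h]

/-- The number of `w` is known only at run time, so every `b` is compared with it, and just one
branch fires, with sums precomputed as constants. All writes go to addresses from register 10 on, so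
earlier layers survive. -/
theorem runs_layerProgram [AddCommGroup G] {e : G ≃ Fin (Nat.card G)} {dst src : ℕ} {w : G}
    {s : State} (hne : src ≠ dst) (hw : s.array src (s.scalar 5) = e w) :
    Runs (layerProgram e dst src) s (Nat.card G * (Nat.card G * (3 * Nat.card G + 3) + 5) + 1)
      fun s' => (∀ a : G, s'.array dst (s.scalar 10 + e a) =
          s.scalar 10 + Nat.card G + e (a + w)) ∧
        ∀ i < s.scalar 10, s'.array dst i = s.array dst i := by
  refine Runs.unroll (fun b s' => ((e w : ℕ) < b → ∀ a : G, s'.array dst (s.scalar 10 + e a) =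
          s.scalar 10 + Nat.card G + e (a + w)) ∧
        ∀ i < s.scalar 10, s'.array dst i = s.array dst i) ?_ ?_ ?_
  · exact ⟨fun h => absurd h (by omega), fun _ _ => rfl⟩
  · intro b hb s₁ hF h₁
    have e1 : s₁.array src (s₁.scalar 5) = e w := by
      rw [hF.1 5 (writesScalar_layerProgram e dst src 5), hF.2 src (writesArray_layerProgram e hne), hw]
    have e2 : s₁.scalar 10 = s.scalar 10 := hF.1 10 (writesScalar_layerProgram e dst src 10)
    refine Runs.le (Runs.ifThenElse (T := Nat.card G * (3 * Nat.card G + 3) + 1) (fun h => ?_)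
      fun h => (Runs.skip ?_).le (by omega)) (by simp [Test.cost, Expr.cost]; omega)
    · simp only [Test.Holds, Expr.eval, e1] at h
      refine Runs.unroll (fun A s' => (∀ a : G, (e a : ℕ) < A → s'.array dst (s.scalar 10 + e a) =
          s.scalar 10 + Nat.card G + e (a + w)) ∧
        ∀ i < s.scalar 10, s'.array dst i = s.array dst i) ?_ ?_ ?_
      · exact ⟨fun a ha => absurd ha (by omega), h₁.2⟩
      · intro A hA s₂ hF' h₂
        have e3 : s₂.scalar 10 = s.scalar 10 := by
          rw [hF'.1 10 (by simp [writesScalar_unroll, Program.WritesScalar]), e2]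
        refine (Runs.setCell ?_).le ?_
        · simp only [Expr.eval_add, Expr.eval, e3]
          refine ⟨fun a ha => ?_, fun i hi => ?_⟩
          · by_cases haA : (e a : ℕ) = A
            · simp [← h, ← haA, addNumber_apply, Nat.add_assoc]
            · simpa [haA] using h₂.1 a (by omega)
          · have : i ≠ s.scalar 10 + A := by omega
            simpa [this] using h₂.2 i hi
        · have := addNumber_le e A b
          simp only [Expr.cost_add, Expr.cost]
          omega
      · exact fun s' hI => ⟨fun _ a => hI.1 a (e a).2, hI.2⟩
    · simp only [Test.Holds, Expr.eval, e1] at h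
      exact ⟨fun h' => h₁.1 (by omega), h₁.2⟩
  · exact fun s' hI => ⟨hI.1 (e w).2, hI.2⟩

/-- Fill the arrays 10, 11 and 12. -/
noncomputable def tablesProgram [AddCommGroup G] (e : G ≃ Fin (Nat.card G)) : Program :=
  .seq (forTo 5 (.scalar 0) <|
    .seq (layerProgram e 10 4) <|
    .seq (layerProgram e 11 5) <|
    .setScalar 10 (.add (.scalar 10) (Nat.card G)))
  (unroll (fun a => .setCell 12 (.add (.scalar 10) a) (.cell 6 (.const a))) (Nat.card G))

theorem keepsInput_tablesProgram [AddCommGroup G] (e : G ≃ Fin (Nat.card G)) :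
    KeepsInput (tablesProgram e) := by
  constructor <;> intro x hx
  · have : x ≠ 5 ∧ x ≠ 10 := by omega
    simp [tablesProgram, forTo, writesScalar_unroll, Program.WritesScalar,
      writesScalar_layerProgram, this]
  · have h : x ≠ 10 ∧ x ≠ 11 ∧ x ≠ 12 := by omega
    simp [tablesProgram, forTo, writesArray_unroll, Program.WritesArray,
      writesArray_layerProgram, h]

/-- Number of steps sufficient for `tablesProgram`. -/
def tablesCost (n g : ℕ) : ℕ :=
  n * (2 * (g * (g * (3 * g + 3) + 5) + 1) + g + 8) + g * (g + 4) + 6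

theorem runs_tablesProgram [AddCommGroup G] {e : G ≃ Fin (Nat.card G)} {Φ : TwoSatMod G n m}
    {s : State} (hs : Loaded e Φ s) (h10 : s.scalar 10 = 0) :
    Runs (tablesProgram e) s (tablesCost n (Nat.card G)) (Tables e Φ) := by
  have hkeep := keepsInput_tablesProgram e
  refine Runs.le (Runs.seq (T := n * (2 * (Nat.card G * (Nat.card G * (3 * Nat.card G + 3) + 5) + 1) + Nat.card G + 8) + 5)
    (T' := Nat.card G * (Nat.card G + 4) + 1)
    (B := fun s => s.scalar 10 = n * Nat.card G ∧
      (∀ (v : Fin n) a, s.array 10 (v * Nat.card G + e a) = (v + 1) * Nat.card G + e (a + Φ.weight v false)) ∧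
      ∀ (v : Fin n) a, s.array 11 (v * Nat.card G + e a) = (v + 1) * Nat.card G + e (a + Φ.weight v true))
    ?_ fun s₁ hF₁ h₁ => ?_) (by simp only [tablesCost]; omega)
  · refine Runs.le (Runs.forTo (N := n) (T := 2 * (Nat.card G * (Nat.card G * (3 * Nat.card G + 3) + 5) + 1) + Nat.card G + 2)
      (fun k s => s.scalar 10 = k * Nat.card G ∧
      (∀ v : Fin n, v < k → ∀ a, s.array 10 (v * Nat.card G + e a) =
        (v + 1) * Nat.card G + e (a + Φ.weight v false)) ∧
      ∀ v : Fin n, v < k → ∀ a, s.array 11 (v * Nat.card G + e a) =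
        (v + 1) * Nat.card G + e (a + Φ.weight v true)) ?_ ?_ ?_ ?_) (by simp [Expr.cost])
    · simp [h10]
    · exact fun s hF => (hF.1 0 (by
        simp [forTo, Program.WritesScalar, writesScalar_layerProgram])).trans hs.vars
    · intro k hk s₁ hF hi hI
      have hs₁ : Loaded e Φ s₁ := hs.frame (P := tablesProgram e)
        (hF.mono (fun _ => Or.inl) fun _ => Or.inl) hkeep
      -- Earlier layers lie entirely below the address where the current one starts.
      have hlt : ∀ v : Fin n, v < k → ∀ a, (v : ℕ) * Nat.card G + e a < k * Nat.card G := by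
        intro v hv a
        have : (v + 1) * Nat.card G ≤ k * Nat.card G := Nat.mul_le_mul_right _ hv
        have := (e a).2
        nlinarith
      have hw4 : s₁.array 4 (s₁.scalar 5) = e (Φ.weight ⟨k, hk⟩ false) := by
        rw [hs₁.input 4 (by omega), hi]
        simp [TwoSatMod.input, hk]
      refine Runs.le ((runs_layerProgram (by norm_num) hw4).seq fun s₂ hF₂ h₂ =>
        Runs.seq (runs_layerProgram (w := Φ.weight ⟨k, hk⟩ true) (by norm_num) ?_)
          fun s₃ hF₃ h₃ => Runs.setScalar ?_) ?_
      · rw [hF₂.1 5 (writesScalar_layerProgram _ _ _ _),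
          hF₂.2 5 (writesArray_layerProgram _ (by norm_num)), hs₁.input 5 (by omega), hi]
        simp [TwoSatMod.input, hk]
      · have e2 : s₂.scalar 10 = k * Nat.card G := by
          rw [hF₂.1 10 (writesScalar_layerProgram _ _ _ _), hI.1]
        have e3 : s₃.scalar 10 = k * Nat.card G := by
          rw [hF₃.1 10 (writesScalar_layerProgram _ _ _ _), e2]
        have e5 : s₃.scalar 5 = k := by
          rw [hF₃.1 5 (writesScalar_layerProgram _ _ _ _),
            hF₂.1 5 (writesScalar_layerProgram _ _ _ _), hi]
        have a10 : s₃.array 10 = s₂.array 10 := hF₃.2 10 (writesArray_layerProgram _ (by norm_num))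
        have a11 : s₂.array 11 = s₁.array 11 := hF₂.2 11 (writesArray_layerProgram _ (by norm_num))
        rw [hI.1] at h₂
        rw [e2, a11] at h₃
        refine ⟨by simpa using e5, by simp [Expr.eval, e3, Nat.add_mul], fun v hv a => ?_,
          fun v hv a => ?_⟩
        · rw [State.array_setScalar, State.array_setScalar, a10]
          rcases Nat.lt_succ_iff_lt_or_eq.1 hv with hv | hv
          · rw [h₂.2 _ (hlt v hv a), hI.2.1 v hv a]
          · obtain rfl : v = ⟨k, hk⟩ := Fin.ext hv
            rw [h₂.1 a]
            ring
        · rw [State.array_setScalar, State.array_setScalar]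
          rcases Nat.lt_succ_iff_lt_or_eq.1 hv with hv | hv
          · rw [h₃.2 _ (hlt v hv a), hI.2.2 v hv a]
          · obtain rfl : v = ⟨k, hk⟩ := Fin.ext hv
            rw [h₃.1 a]
            ring
      · simp only [Expr.cost_add, Expr.cost]
        omega
    · exact fun s _ h => ⟨h.1, fun v => h.2.1 v v.2, fun v => h.2.2 v v.2⟩
  · refine Runs.unroll (fun A s => Loaded e Φ s ∧ s.scalar 10 = n * Nat.card G ∧
      (∀ (v : Fin n) a, s.array 10 (v * Nat.card G + e a) = (v + 1) * Nat.card G + e (a + Φ.weight v false)) ∧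
      (∀ (v : Fin n) a, s.array 11 (v * Nat.card G + e a) = (v + 1) * Nat.card G + e (a + Φ.weight v true)) ∧
      ∀ a : G, (e a : ℕ) < A → (s.array 12 (n * Nat.card G + e a) = 1 ↔ a ∈ Φ.target)) ?_ ?_ ?_
    · exact ⟨hs.frame (P := tablesProgram e) (hF₁.mono (fun _ => Or.inl) fun _ => Or.inl) hkeep,
        h₁.1, h₁.2.1, h₁.2.2, fun a ha => absurd ha (by omega)⟩
    · rintro A hA s₂ - ⟨hL, h10, hl, hr, ht⟩
      refine (Runs.setCell ?_).le ?_
      · refine ⟨⟨hL.vars, hL.clauses, fun a ha => ?_⟩, h10, by simpa using hl, by simpa using hr,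
          fun a ha => ?_⟩
        · rw [← hL.input a ha]
          funext i
          have : a ≠ 12 := by omega
          simp [this]
        · simp only [Expr.eval_add, Expr.eval, h10, State.array_setCell, true_and]
          by_cases haA : (e a : ℕ) = A
          · subst haA
            rw [if_pos rfl, hL.input 6 (by omega)]
            simp [TwoSatMod.input]
          · simpa [haA] using ht a (by omega)
      · simp only [Expr.cost_add, Expr.cost]
        omega
    · exact fun s h => ⟨h.2.2.1, h.2.2.2.1, fun a => h.2.2.2.2 a (e a).2⟩

/-! ## Testing one assignment

Scalar register 6 is a pointer, and 7 reports success. -/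

/-- If a solution has been reported, then the array 7 holds one. -/
def Sound [AddCommGroup G] (Φ : TwoSatMod G n m) (s : State) : Prop :=
  s.scalar 7 = 0 ∨ s.scalar 7 = 1 ∧ ∃ z, Φ.IsSolution z ∧ ∀ j : Fin n, s.array 7 j = (z j).toNat

/-- Test the assignment in the array `x`, and report it if it satisfies the global constraint; `o`
is the number of the neutral element. -/
def testProgram (o x : ℕ) : Program :=
  .seq (.setScalar 6 (.const o)) <|
  .seq (forTo 5 (.scalar 0) <| .ifThenElse (.eq (.cell x (.scalar 5)) (.const 1))
    (.setScalar 6 (.cell 10 (.scalar 6))) (.setScalar 6 (.cell 11 (.scalar 6)))) <|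
  .ifThenElse (.eq (.cell 12 (.scalar 6)) (.const 1))
    (.seq (forTo 5 (.scalar 0) (.setCell 7 (.scalar 5) (.pred (.cell x (.scalar 5)))))
      (.setScalar 7 (.const 1)))
    .skip

theorem runs_testProgram [AddCommGroup G] {e : G ≃ Fin (Nat.card G)} {Φ : TwoSatMod G n m} {x : ℕ}
    {z : Fin n → Bool} {s : State} (hs : Loaded e Φ s) (ht : Tables e Φ s) (hx : x ≠ 7)
    (hz : Φ.Satisfies z) (hxz : Encodes (s.array x) fun v => some (z v)) (hS : Sound Φ s) :
    Runs (testProgram (e 0) x) s (n * 24 + 18) fun s' => Sound Φ s' ∧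
      (s.scalar 7 = 1 → s'.scalar 7 = 1) ∧
      (∑ j, Φ.weight j (z j) ∈ Φ.target → s'.scalar 7 = 1) := by
  let f : ℕ → G := fun j => if h : j < n then Φ.weight ⟨j, h⟩ (z ⟨j, h⟩) else 0
  have hf : ∑ j ∈ Finset.range n, f j = ∑ j, Φ.weight j (z j) := by
    rw [Finset.sum_range]
    exact Finset.sum_congr rfl fun j _ => by simp [f]
  refine Runs.le (Runs.seq (T := 2) (B := fun s' => s' = s.setScalar 6 (e 0)) (Runs.setScalar rfl)
    fun s₁ hF₁ h₁ => Runs.seq (T := n * 13 + 5)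
      (B := fun s => s.scalar 6 = n * Nat.card G + e (∑ j, Φ.weight j (z j))) ?_ fun s₂ hF₂ h₂ =>
    Runs.ifThenElse (T := n * 11 + 7) (fun h => Runs.seq (T := n * 11 + 5) (T' := 2)
      (B := fun s => ∀ j : Fin n, s.array 7 j = (z j).toNat) ?_ fun s₃ hF₃ h₃ => Runs.setScalar ?_)
      fun h => (Runs.skip ?_).le (by omega))
    (by simp only [Test.cost, Expr.cost]; omega)
  · refine Runs.le (Runs.forTo (N := n) (T := 7)
      -- Register 6 is the address of the pair of `k` and the partial sum; it starts at `e 0`, the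
      -- address of `(0, 0)`.
      (fun k s => s.scalar 6 = k * Nat.card G + e (∑ j ∈ Finset.range k, f j)) ?_ ?_ ?_ ?_)
      (by simp [Expr.cost])
    · simp [h₁]
    · intro s hF
      rw [Expr.eval, hF.1 0 (by simp [forTo, Program.WritesScalar]), h₁]
      exact hs.vars
    · intro k hk s₂ hF hi hI
      have ax : s₂.array x k = code (some (z ⟨k, hk⟩)) := by
        rw [hF.2 x (by simp [forTo, Program.WritesArray]), h₁]
        exact hxz ⟨k, hk⟩
      have a10 : s₂.array 10 = s.array 10 := by
        rw [hF.2 10 (by simp [forTo, Program.WritesArray]), h₁, State.array_setScalar]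
      have a11 : s₂.array 11 = s.array 11 := by
        rw [hF.2 11 (by simp [forTo, Program.WritesArray]), h₁, State.array_setScalar]
      have hfk : f k = Φ.weight ⟨k, hk⟩ (z ⟨k, hk⟩) := by simp [f, hk]
      refine Runs.le (Runs.ifThenElse (T := 3) (fun h => (Runs.setScalar ?_).le (by simp [Expr.cost]))
        fun h => (Runs.setScalar ?_).le (by simp [Expr.cost])) (by simp [Test.cost, Expr.cost])
      all_goals
        simp only [Test.Holds, Expr.eval, hi, ax, hI, a10, a11, code] at h ⊢
        refine ⟨by simpa using hi, ?_⟩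
        rw [Finset.sum_range_succ, hfk]
      · have : z ⟨k, hk⟩ = false := by
          cases hv : z ⟨k, hk⟩ <;> simp_all
        rw [this]
        simpa using ht.left ⟨k, hk⟩ _
      · have : z ⟨k, hk⟩ = true := by
          cases hv : z ⟨k, hk⟩ <;> simp_all
        rw [this]
        simpa using ht.right ⟨k, hk⟩ _
    · intro s _ h
      rw [h, hf]
  · have ax : s₂.array x = s.array x := by
      rw [hF₂.2 x (by simp [forTo, Program.WritesArray]), h₁, State.array_setScalar]
    refine Runs.le (Runs.forTo (N := n) (T := 5)
      (fun k s => ∀ j : Fin n, j < k → s.array 7 j = (z j).toNat) ?_ ?_ ?_ ?_)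
      (by simp [Expr.cost])
    · exact fun j hj => absurd hj (by omega)
    · intro s hF
      rw [Expr.eval, hF.1 0 (by simp [forTo, Program.WritesScalar]),
        hF₂.1 0 (by simp [forTo, Program.WritesScalar]), h₁]
      exact hs.vars
    · intro k hk s₃ hF hi hI
      have ax' : s₃.array x k = code (some (z ⟨k, hk⟩)) := by
        rw [hF.2 x (by simp [forTo, Program.WritesArray, hx]), ax]
        exact hxz ⟨k, hk⟩
      refine (Runs.setCell ?_).le (by simp [Expr.cost])
      simp only [Expr.eval, hi, ax', code]
      refine ⟨hi, fun j hj => ?_⟩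
      by_cases hjk : (j : ℕ) = k
      · obtain rfl : j = ⟨k, hk⟩ := Fin.ext hjk
        simp
      · simpa [hjk] using hI j (by omega)
    · exact fun s _ h j => h j j.2
  · have a12 : s₂.array 12 = s.array 12 := by
      rw [hF₂.2 12 (by simp [forTo, Program.WritesArray]), h₁, State.array_setScalar]
    simp only [Test.Holds, Expr.eval, a12, h₂] at h
    refine ⟨.inr ⟨by simp [Expr.eval], z, ⟨hz, (ht.goal _).1 h⟩, h₃⟩, ?_, ?_⟩ <;> simp [Expr.eval]
  · have a12 : s₂.array 12 = s.array 12 := by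
      rw [hF₂.2 12 (by simp [forTo, Program.WritesArray]), h₁, State.array_setScalar]
    have a7 : s₂.array 7 = s.array 7 := by
      rw [hF₂.2 7 (by simp [forTo, Program.WritesArray]), h₁, State.array_setScalar]
    have c7 : s₂.scalar 7 = s.scalar 7 := by
      rw [hF₂.1 7 (by simp [forTo, Program.WritesScalar]), h₁]
      simp
    simp only [Test.Holds, Expr.eval, a12, h₂] at h
    refine ⟨?_, fun h' => c7.trans h', fun h' => absurd ((ht.goal _).2 h') h⟩
    rw [Sound, c7, a7]
    exact hS

end TwoSatMod

namespace TwoSatMod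

open RAM

variable {G : Type u} {n m : ℕ}

/-! ## Finding an assignment that satisfies all clauses -/

/-- Assign the variables one after the other. The array `y` holds the partial assignment found so
far, and register 9 reports that there is none that satisfies all clauses. -/
def satProgram (y : ℕ) : Program :=
  forTo 8 (.scalar 0) <|
    .seq (.setScalar 11 (.const 2)) <|
    .seq (propagateProgram 8) <|
    .ifThenElse (.eq (.scalar 2) (.const 0)) (overrideProgram y y) <|
    .seq (.setScalar 11 (.const 1)) <|
    .seq (propagateProgram 8) <|
    .ifThenElse (.eq (.scalar 2) (.const 0)) (overrideProgram y y) <|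
    .setScalar 9 (.const 1)

theorem keepsInput_satProgram {y : ℕ} (hy : 8 < y) : KeepsInput (satProgram y) := by
  constructor <;> intro x hx <;>
    simp [satProgram, propagateProgram, sweepProgram, overrideProgram, forTo, forceProgram,
      Program.WritesScalar, Program.WritesArray] <;> omega

/-- Number of steps sufficient for `satProgram`. -/
def satCost (n m : ℕ) : ℕ := n * (2 * propagateCost n m + n * 14 + 21) + 5

theorem writesScalar_propagateProgram {x v : ℕ} :
    (propagateProgram x).WritesScalar v → 2 ≤ v ∧ v ≤ 5 := by
  simp only [propagateProgram, sweepProgram, forTo, forceProgram, Program.WritesScalar, false_or]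
  omega

theorem writesArray_propagateProgram {x a : ℕ} :
    (propagateProgram x).WritesArray a → a = 8 := by
  simp [propagateProgram, sweepProgram, forTo, forceProgram, Program.WritesArray]

theorem writesScalar_overrideProgram {x y v : ℕ} :
    (overrideProgram x y).WritesScalar v → v = 5 := by
  simp [overrideProgram, forTo, Program.WritesScalar]

theorem writesArray_overrideProgram {x y a : ℕ} :
    (overrideProgram x y).WritesArray a → a = y := by
  simp [overrideProgram, forTo, Program.WritesArray]

theorem not_satisfies_of_conflict {Φ : TwoSatMod G n m} {a : Fin n}
    (h : (Φ.propagate a true).2 = true) (h' : (Φ.propagate a false).2 = true)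
    (z : Fin n → Bool) : ¬ Φ.Satisfies z := by
  intro hz
  have := (propagate_below hz a).1
  cases hza : z a <;> simp_all

/-- No backtracking is needed: overriding by a propagation without conflict keeps the partial
assignment closed. Propagation starts from the empty assignment, so conflicts for both values refute
the clauses themselves, whatever was chosen before. -/
theorem runs_satProgram {e : G ≃ Fin (Nat.card G)} {Φ : TwoSatMod G n m} {y : ℕ} {s : State}
    (hy : 8 < y) (hs : Loaded e Φ s) (h9 : s.scalar 9 = 0) (hY : ∀ i, s.array y i = 0) :
    Runs (satProgram y) s (satCost n m) fun s' =>
      (s'.scalar 9 ≠ 0 ∧ ∀ z, ¬ Φ.Satisfies z) ∨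
      (s'.scalar 9 = 0 ∧ ∃ z, Φ.Satisfies z ∧ Encodes (s'.array y) fun v => some (z v)) := by
  let Inv : ℕ → State → Prop := fun k s => ∃ p : Fin n → Option Bool, Encodes (s.array y) p ∧
    ((s.scalar 9 = 1 ∧ ∀ z, ¬ Φ.Satisfies z) ∨
      (s.scalar 9 = 0 ∧ Φ.Closed p ∧ ∀ v : Fin n, v < k → p v ≠ none))
  refine Runs.le (Runs.forTo (N := n) (T := 2 * propagateCost n m + n * 14 + 15) Inv ?_ ?_ ?_ ?_)
    (by simp [Expr.cost, satCost])
  · exact ⟨fun _ => none, fun v => hY v, .inr ⟨by simpa using h9, fun k => by simp, by simp⟩⟩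
  · exact fun s hF => (hs.frame hF (keepsInput_satProgram hy)).vars
  · rintro k hk s₁ hF hi ⟨p, hp, hI⟩
    have hs₁ := hs.frame hF (keepsInput_satProgram hy)
    set a : Fin n := ⟨k, hk⟩ with ha
    have hset : ∀ b, KeepsInput (.setScalar 11 (.const b)) := fun b =>
      ⟨fun x hx => by simp [Program.WritesScalar]; omega, fun x hx => by simp [Program.WritesArray]⟩
    -- Both values are tried alike; `R` is what runs upon a conflict, with `T` steps allowed to it
    -- beyond the cost of an override.
    have try_value : ∀ (b : Bool) (t : State) (T : ℕ) (R : Program), Loaded e Φ t → t.scalar 8 = k →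
        t.array y = s₁.array y → t.scalar 9 = s₁.scalar 9 →
        (∀ t', Loaded e Φ t' → t'.scalar 8 = k → t'.array y = s₁.array y →
          t'.scalar 9 = s₁.scalar 9 → (Φ.propagate a b).2 = true → Runs R t' (n * 14 + 5 + T)
            fun s' => s'.scalar 8 = k ∧ Inv (k + 1) (s'.setScalar 8 (k + 1))) →
        Runs (.seq (.setScalar 11 (.const (b.toNat + 1))) <| .seq (propagateProgram 8) <|
          .ifThenElse (.eq (.scalar 2) (.const 0)) (overrideProgram y y) R) t
          (2 + (propagateCost n m + (3 + (n * 14 + 5 + T))))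
          fun s' => s'.scalar 8 = k ∧ Inv (k + 1) (s'.setScalar 8 (k + 1)) := by
      intro b t T R ht h8 hty ht9 hR
      refine Runs.seq (T := 2) (B := fun t' => t' = t.setScalar 11 (b.toNat + 1)) (Runs.setScalar rfl)
        fun t₁ hF₁ h₁ => Runs.seq (runs_propagateProgram (a := a) (b := b) (ht.frame hF₁ (hset _))
          (by norm_num) (by norm_num) (by simp [h₁, h8, ha]) (by simp [h₁])) fun t₂ hF₂ h₂ => ?_
      have l2 : Loaded e Φ t₂ := (ht.frame hF₁ (hset _)).frame hF₂ (keepsInput_propagateProgram _)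
      have e8 : t₂.scalar 8 = k := by
        rw [hF₂.1 8 fun h => by have := writesScalar_propagateProgram h; omega, h₁]
        simpa using h8
      have e9 : t₂.scalar 9 = s₁.scalar 9 := by
        rw [hF₂.1 9 fun h => by have := writesScalar_propagateProgram h; omega, h₁]
        simpa using ht9
      have ey : t₂.array y = s₁.array y := by
        rw [hF₂.2 y fun h => by have := writesArray_propagateProgram h; omega, h₁]
        simpa using hty
      refine Runs.ifThenElse (fun h => ?_) fun h => hR t₂ l2 e8 ey e9 ?_
      · have hc : (Φ.propagate a b).2 = false := by
          simp only [Test.Holds, Expr.eval, h₂.2] at h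
          simpa using h
        refine ((runs_overrideProgram (q := p) l2.vars (by omega) h₂.1 (by rw [ey]; exact hp)).le
          (Nat.le_add_right _ T)).imp fun t₃ hF₃ h₃ => ⟨?_, _, h₃, ?_⟩
        · rw [hF₃.1 8 fun h => by have := writesScalar_overrideProgram h; omega, e8]
        · have e9' : (t₃.setScalar 8 (k + 1)).scalar 9 = s₁.scalar 9 := by
            simp [hF₃.1 9 fun h => by have := writesScalar_overrideProgram h; omega, e9]
          rw [e9']
          refine hI.imp id fun ⟨h9, hcl, hdef⟩ => ⟨h9, (propagate_closed hc).override hcl, fun v hv => ?_⟩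
          rcases Nat.lt_succ_iff_lt_or_eq.1 hv with hv | hv
          · obtain ⟨c, hc⟩ := Option.ne_none_iff_exists'.1 (hdef v hv)
            cases hpv : (Φ.propagate a b).1 v <;> simp [override, hc, hpv]
          · obtain rfl : v = a := Fin.ext hv
            simp [override, propagate_self]
      · simp only [Test.Holds, Expr.eval, h₂.2] at h
        cases hc : (Φ.propagate a b).2 with
        | true => rfl
        | false => simp [hc] at h
    refine (try_value true s₁ (propagateCost n m + 5) _ hs₁ hi rfl rfl
      fun t l8 e8 ey e9 hc => ?_).le (by omega)
    refine (try_value false t 0 _ l8 e8 ey e9 fun t' l8' e8' ey' e9' hc' => ?_).le (by omega)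
    refine (Runs.setScalar ?_).le (by simp [Expr.cost])
    exact ⟨by simpa using e8', p, by simpa [ey'] using hp,
      .inl ⟨by simp [Expr.eval], not_satisfies_of_conflict hc hc'⟩⟩
  · rintro s' - ⟨p, hp, ⟨h9, h⟩ | ⟨h9, hcl, hdef⟩⟩
    · exact .inl ⟨by omega, h⟩
    · choose z hz using fun v : Fin n => Option.ne_none_iff_exists'.1 (hdef v v.2)
      obtain rfl : p = fun v => some (z v) := funext hz
      exact .inr ⟨h9, z, closed_some_iff.1 hcl, hp⟩

/-! ## Enumerating the solutions generated by few literals -/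

/-- Test all assignments obtained from the one in the array `13 + k` by overriding it at most `k`
times by the consequences of a literal that is false under the assignment in the array `y`. -/
def searchProgram (o y : ℕ) : ℕ → Program
  | 0 => testProgram o 13
  | k + 1 => .seq (testProgram o (13 + (k + 1))) <|
    forTo (13 + k) (.scalar 0) <|
    .seq (.ifThenElse (.eq (.cell y (.scalar (13 + k))) (.const 1))
      (.setScalar 11 (.const 2)) (.setScalar 11 (.const 1))) <|
    .seq (propagateProgram (13 + k)) <|
    .ifThenElse (.eq (.scalar 2) (.const 0))
      (.seq (overrideProgram (13 + (k + 1)) (13 + k)) (searchProgram o y k)) .skip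

/-- Number of steps sufficient for `searchProgram`. -/
def searchCost (n m : ℕ) : ℕ → ℕ
  | 0 => n * 24 + 18
  | k + 1 => n * (propagateCost n m + n * 14 + searchCost n m k + 20) + n * 24 + 23

theorem writesScalar_testProgram {o x v : ℕ} : (testProgram o x).WritesScalar v →
    5 ≤ v ∧ v ≤ 7 := by
  simp only [testProgram, forTo, Program.WritesScalar, or_false, false_or]
  omega

theorem writesArray_testProgram {o x a : ℕ} : (testProgram o x).WritesArray a → a = 7 := by
  simp [testProgram, forTo, Program.WritesArray]

theorem writesScalar_searchProgram {o y k v : ℕ} : (searchProgram o y k).WritesScalar v →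
    2 ≤ v ∧ v ≤ 7 ∨ v = 11 ∨ 13 ≤ v ∧ v < 13 + k := by
  induction k with
  | zero => intro h; have := writesScalar_testProgram h; omega
  | succ k ih =>
    simp only [searchProgram, Program.WritesScalar, forTo]
    rintro (h | h | ((h | h) | h | (h | h) | h) | h)
    · have := writesScalar_testProgram h; omega
    · omega
    · omega
    · omega
    · have := writesScalar_propagateProgram h; omega
    · have := writesScalar_overrideProgram h; omega
    · have := ih h; omega
    · exact h.elim
    · omega

theorem writesArray_searchProgram {o y k a : ℕ} : (searchProgram o y k).WritesArray a →
    a = 7 ∨ a = 8 ∨ 13 ≤ a ∧ a < 13 + k := by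
  induction k with
  | zero => intro h; have := writesArray_testProgram h; omega
  | succ k ih =>
    simp only [searchProgram, Program.WritesArray, forTo, false_or, or_false]
    rintro (h | h | h | h)
    · have := writesArray_testProgram h; omega
    · have := writesArray_propagateProgram h; omega
    · have := writesArray_overrideProgram h; omega
    · have := ih h; omega

theorem keepsInput_searchProgram {o y k : ℕ} : KeepsInput (searchProgram o y k) :=
  ⟨fun x hx h => by have := writesScalar_searchProgram h; omega,
    fun a ha h => by have := writesArray_searchProgram h; omega⟩

/-- Level `k` writes only arrays 7, 8 and those from 13 to `12 + k`, so its own assignment in the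
array `13 + k`, the outer levels and the array `y` survive; `y = 13 + k` is allowed. A success, once
reported, persists through later tests. -/
theorem runs_searchProgram [AddCommGroup G] {e : G ≃ Fin (Nat.card G)} {Φ : TwoSatMod G n m}
    {y k : ℕ} {y' x : Fin n → Bool} {s : State} (hs : Loaded e Φ s) (ht : Tables e Φ s)
    (hk : 13 + k ≤ y) (hy : Encodes (s.array y) fun v => some (y' v)) (hx : Φ.Satisfies x)
    (hxs : Encodes (s.array (13 + k)) fun v => some (x v)) (hS : Sound Φ s) :
    Runs (searchProgram (e 0) y k) s (searchCost n m k) fun s' => Sound Φ s' ∧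
      (s.scalar 7 = 1 → s'.scalar 7 = 1) ∧ (Φ.Hits y' k x → s'.scalar 7 = 1) := by
  induction k generalizing x s with
  | zero => exact runs_testProgram hs ht (by norm_num) hx hxs hS
  | succ k ih =>
    let L := searchProgram (e 0) y (k + 1)
    have hseq : ∀ {t t' : State}, Frame L t t' → Loaded e Φ t → Tables e Φ t →
        Encodes (t.array y) (fun v => some (y' v)) →
        Encodes (t.array (13 + (k + 1))) (fun v => some (x v)) →
        Loaded e Φ t' ∧ Tables e Φ t' ∧ Encodes (t'.array y) (fun v => some (y' v)) ∧
        Encodes (t'.array (13 + (k + 1))) fun v => some (x v) := by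
      intro t t' hF h1 h2 h3 h4
      refine ⟨h1.frame hF keepsInput_searchProgram, h2.frame hF ?_ ?_ ?_, ?_, ?_⟩
      · exact fun h => by have := writesArray_searchProgram h; omega
      · exact fun h => by have := writesArray_searchProgram h; omega
      · exact fun h => by have := writesArray_searchProgram h; omega
      · rwa [hF.2 y fun h => by have := writesArray_searchProgram h; omega]
      · rwa [hF.2 _ fun h => by have := writesArray_searchProgram h; omega]
    refine Runs.le (Runs.seq (runs_testProgram hs ht (by omega) hx hxs hS) fun s₁ hF₁ h₁ =>
      Runs.forTo (N := n) (T := propagateCost n m + n * 14 + searchCost n m k + 14)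
      (fun i t => Sound Φ t ∧ (s.scalar 7 = 1 → t.scalar 7 = 1) ∧
        ((∑ j, Φ.weight j (x j) ∈ Φ.target ∨ ∃ a : Fin n, a < i ∧
          (Φ.propagate a (!y' a)).2 = false ∧ Φ.Hits y' k (extend (Φ.propagate a (!y' a)).1 x)) →
          t.scalar 7 = 1)) ?_ ?_ ?_ ?_) (by simp only [searchCost, Expr.cost]; ring_nf; omega)
    · have e7 : (s₁.setScalar (13 + k) 0).scalar 7 = s₁.scalar 7 := by
        rw [State.scalar_setScalar, if_neg (by omega)]
      rw [Sound, e7]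
      refine ⟨h₁.1, h₁.2.1, ?_⟩
      rintro (h | ⟨a, ha, -⟩)
      · exact h₁.2.2 h
      · omega
    · intro t hF
      obtain ⟨h1, h2, h3, h4⟩ := hseq (Frame.mono hF₁ (fun _ => Or.inl) fun _ => Or.inl) hs ht hy hxs
      exact (hseq (Frame.mono hF (fun _ => Or.inr) fun _ => Or.inr) h1 h2 h3 h4).1.vars
    · rintro i hi t hF hti ⟨hS₁, hmono, hhit⟩
      obtain ⟨h1, h2, h3, h4⟩ := hseq (Frame.mono hF₁ (fun _ => Or.inl) fun _ => Or.inl) hs ht hy hxs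
      obtain ⟨h1, h2, h3, h4⟩ := hseq (Frame.mono hF (fun _ => Or.inr) fun _ => Or.inr) h1 h2 h3 h4
      set a : Fin n := ⟨i, hi⟩ with ha
      have hya := h3 a
      refine Runs.le (Runs.seq (T := 6) (B := fun t' => t' = t.setScalar 11 ((!y' a).toNat + 1)) ?_
        fun t₁ hG₁ e₁ => Runs.seq (T' := 8 + n * 14 + searchCost n m k)
        (runs_propagateProgram (e := e) (Φ := Φ) (a := a) (b := !y' a) ?_ (by omega) (by omega) ?_ ?_)
        fun t₂ hG₂ e₂ => ?_) (by omega)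
      -- Code 1 means that `y'` is false at `a`, so the literal to impose is true, of code 2, and
      -- vice versa.
      · refine Runs.le (Runs.ifThenElse (T := 2) (fun h => Runs.setScalar ?_)
          fun h => Runs.setScalar ?_) (by simp [Test.cost, Expr.cost])
        all_goals
          simp only [Test.Holds, Expr.eval, hti] at h ⊢
          rw [show i = (a : ℕ) from rfl, hya] at h
          cases hb : y' a <;> simp_all [code]
      · rw [e₁]
        exact ⟨by simpa using h1.vars, by simpa using h1.clauses, h1.input⟩
      · rw [e₁, State.scalar_setScalar, if_neg (by omega), hti]
      · simp [e₁]
      · have hG : Frame L t t₂ := by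
          refine Frame.trans (Frame.mono hG₁ (fun x h => ?_) fun a h => ?_)
            (Frame.mono hG₂ (fun x h => ?_) fun a h => ?_)
          · exact .inr (.inr (.inl (.inl h)))
          · exact .inr (.inr (.inl (.inl h)))
          · exact .inr (.inr (.inl (.inr (.inl h))))
          · exact .inr (.inr (.inl (.inr (.inl h))))
        obtain ⟨h1, h2, h3, h4⟩ := hseq hG h1 h2 h3 h4
        have hti₂ : t₂.scalar (13 + k) = i := by
          rw [hG₂.1 _ fun h => by have := writesScalar_propagateProgram h; omega, e₁,
            State.scalar_setScalar, if_neg (by omega), hti]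
        have e7 : t₂.scalar 7 = t.scalar 7 := by
          rw [hG₂.1 _ fun h => by have := writesScalar_propagateProgram h; omega, e₁,
            State.scalar_setScalar, if_neg (by omega)]
        have a7 : t₂.array 7 = t.array 7 := by
          rw [hG₂.2 _ fun h => by have := writesArray_propagateProgram h; omega, e₁,
            State.array_setScalar]
        have hS₂ : Sound Φ t₂ := by rwa [Sound, e7, a7]
        have hset : ∀ t' : State, (t'.setScalar (13 + k) (i + 1)).scalar 7 = t'.scalar 7 := by
          intro t'
          rw [State.scalar_setScalar, if_neg (by omega)]
        refine Runs.le (Runs.ifThenElse (T := n * 14 + 5 + searchCost n m k) (fun h => ?_)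
          fun h => (Runs.skip ?_).le (by omega)) (by simp only [Test.cost, Expr.cost]; omega)
        · have hc : (Φ.propagate a (!y' a)).2 = false := by
            simp only [Test.Holds, Expr.eval, e₂.2] at h
            simpa using h
          refine Runs.seq (runs_overrideProgram h1.vars (by omega) e₂.1 h4) fun t₃ hG₃ e₃ => ?_
          have hG₃' : Frame L t₂ t₃ := Frame.mono hG₃
            (fun x h => .inr (.inr (.inl (.inr (.inr (.inl (.inl h)))))))
            fun x h => .inr (.inr (.inl (.inr (.inr (.inl (.inl h))))))
          obtain ⟨h1, h2, h3, h4⟩ := hseq hG₃' h1 h2 h3 h4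
          have e7' : t₃.scalar 7 = t₂.scalar 7 :=
            hG₃.1 _ fun h => by have := writesScalar_overrideProgram h; omega
          have a7' : t₃.array 7 = t₂.array 7 :=
            hG₃.2 _ fun h => by have := writesArray_overrideProgram h; omega
          have hti₃ : t₃.scalar (13 + k) = i := by
            rw [hG₃.1 _ fun h => by have := writesScalar_overrideProgram h; omega, hti₂]
          rw [override_some] at e₃
          refine (ih h1 h2 (by omega) h3 (hx.extend (propagate_closed hc)) e₃
            (by rwa [Sound, e7', a7'])).imp fun t₄ hG₄ e₄ => ⟨?_, ?_⟩
          · rw [hG₄.1 _ fun h => by have := writesScalar_searchProgram h; omega, hti₃]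
          · rw [Sound, hset]
            refine ⟨e₄.1, fun h => e₄.2.1 (by rw [e7', e7]; exact hmono h), ?_⟩
            rintro (h | ⟨b, hb, hb'⟩)
            · exact e₄.2.1 (by rw [e7', e7]; exact hhit (.inl h))
            · rcases Nat.lt_succ_iff_lt_or_eq.1 hb with hb | hb
              · exact e₄.2.1 (by rw [e7', e7]; exact hhit (.inr ⟨b, hb, hb'⟩))
              · obtain rfl : b = a := Fin.ext hb
                exact e₄.2.2 hb'.2
        · simp only [Test.Holds, Expr.eval, e₂.2] at h
          refine ⟨hti₂, ?_⟩
          rw [Sound, hset, e7]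
          refine ⟨by rwa [Sound, e7] at hS₂, hmono, ?_⟩
          rintro (h' | ⟨b, hb, hb'⟩)
          · exact hhit (.inl h')
          · rcases Nat.lt_succ_iff_lt_or_eq.1 hb with hb | hb
            · exact hhit (.inr ⟨b, hb, hb'⟩)
            · obtain rfl : b = a := Fin.ext hb
              simp [hb'.1] at h
    · refine fun t _ h => ⟨h.1, h.2.1, fun hh => h.2.2 (Or.imp id ?_ hh)⟩
      rintro ⟨a, ha⟩
      exact ⟨a, a.2, ha⟩

/-! ## The whole algorithm -/

/-- The program solving all instances over the group `G`. -/
noncomputable def solveProgram [AddCommGroup G] (e : G ≃ Fin (Nat.card G)) : Program :=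
  .seq (tablesProgram e) <|
  .seq (satProgram (13 + (Nat.card G - 1))) <|
  .seq (.ifThenElse (.eq (.scalar 9) (.const 0))
    (searchProgram (e 0) (13 + (Nat.card G - 1)) (Nat.card G - 1)) .skip) <|
  .setScalar 0 (.scalar 7)

theorem runs_solveProgram [AddCommGroup G] [Finite G] (e : G ≃ Fin (Nat.card G))
    (Φ : TwoSatMod G n m) :
    Runs (solveProgram e) (Φ.input e) (tablesCost n (Nat.card G) + (satCost n m +
      (4 + searchCost n m (Nat.card G - 1) + 2))) Φ.IsAnswer := by
  unfold solveProgram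
  obtain ⟨K, hK⟩ : ∃ K, Nat.card G - 1 = K := ⟨_, rfl⟩
  rw [hK]
  have hs : Loaded e Φ (Φ.input e) := ⟨rfl, rfl, fun _ _ => rfl⟩
  have hw9 : ¬ (tablesProgram e).WritesScalar 9 := by
    simp [tablesProgram, forTo, writesScalar_unroll, Program.WritesScalar,
      writesScalar_layerProgram]
  have hw7 : ¬ (tablesProgram e).WritesScalar 7 := by
    simp [tablesProgram, forTo, writesScalar_unroll, Program.WritesScalar,
      writesScalar_layerProgram]
  have hwK : ¬ (tablesProgram e).WritesArray (13 + K) := by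
    have h : 13 + K ≠ 10 ∧ 13 + K ≠ 11 ∧ 13 + K ≠ 12 := by omega
    simp [tablesProgram, forTo, writesArray_unroll, Program.WritesArray,
      writesArray_layerProgram, h]
  have hwsat : ∀ a ≠ 8, a ≠ 13 + K → ¬ (satProgram (13 + K)).WritesArray a := by
    intro a h8 hK h
    simp only [satProgram, forTo, Program.WritesArray, false_or, or_false] at h
    rcases h with h | h | h | h
    · exact h8 (writesArray_propagateProgram h)
    · exact hK (writesArray_overrideProgram h)
    · exact h8 (writesArray_propagateProgram h)
    · exact hK (writesArray_overrideProgram h)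
  have hw7' : ¬ (satProgram (13 + K)).WritesScalar 7 := by
    simp [satProgram, propagateProgram, sweepProgram, overrideProgram, forTo, forceProgram,
      Program.WritesScalar]
  -- Zeros encode the empty partial assignment from which `satProgram` starts.
  have hin : ∀ i, (Φ.input e).array (13 + K) i = 0 := fun i => by
    rw [Nat.add_comm]; rfl
  refine Runs.seq (runs_tablesProgram hs rfl) fun s₁ hF₁ h₁ => ?_
  have hs₁ := hs.frame hF₁ (keepsInput_tablesProgram e)
  refine Runs.seq (runs_satProgram (by omega) hs₁ ((hF₁.1 9 hw9).trans rfl)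
    (fun i => by rw [hF₁.2 _ hwK]; exact hin i)) fun s₂ hF₂ h₂ => ?_
  have hs₂ := hs₁.frame hF₂ (keepsInput_satProgram (by omega))
  have ht₂ := h₁.frame hF₂ (hwsat 10 (by omega) (by omega)) (hwsat 11 (by omega) (by omega))
    (hwsat 12 (by omega) (by omega))
  have e7 : s₂.scalar 7 = 0 := by rw [hF₂.1 7 hw7', hF₁.1 7 hw7]; rfl
  refine Runs.seq (B := fun s => Sound Φ s ∧ ((∃ z, Φ.IsSolution z) → s.scalar 7 = 1)) ?_
    fun s₃ hF₃ h₃ => Runs.setScalar ?_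
  · refine Runs.le (Runs.ifThenElse (T := searchCost n m K + 1) (fun h => ?_)
      fun h => (Runs.skip ?_).le (by omega)) (by simp only [Test.cost, Expr.cost]; omega)
    · rcases h₂ with ⟨h9, -⟩ | ⟨-, y, hy, hye⟩
      · exact absurd h h9
      -- The array `13 + K` serves both as the reference assignment and as the starting point.
      · refine (runs_searchProgram hs₂ ht₂ le_rfl hye hy hye (.inl e7)).mono (by omega)
          fun s' h' => ⟨h'.1, fun ⟨z, hz⟩ => h'.2.2 (hK ▸ hits_of_isSolution hy hz)⟩
    · rcases h₂ with ⟨-, hno⟩ | ⟨h9, -⟩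
      · exact ⟨.inl e7, fun ⟨z, hz⟩ => absurd hz.1 (hno z)⟩
      · exact absurd h9 h
  · obtain ⟨h | ⟨h, hz⟩, h'⟩ := h₃
    · exact .inr ⟨by simpa [Expr.eval] using h, fun z hz => by simp [h' ⟨z, hz⟩] at h⟩
    · exact .inl ⟨by simpa [Expr.eval] using h, by simpa using hz⟩

/-! ## The number of steps -/

/-- From 10 on, passing from `g` to `g + 1` at most doubles the cube. This makes the cost of the
tables fit an exponent `g` plus an absolute constant. -/
theorem pow_three_le_two_pow (g : ℕ) : g ^ 3 ≤ 2 ^ (g + 2) := by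
  by_cases hg : g < 10
  · interval_cases g <;> norm_num
  · induction g with
    | zero => omega
    | succ g ih =>
      by_cases h : g < 10
      · obtain rfl : g = 9 := by omega
        norm_num
      · have := ih h
        have h1 : (g + 1) ^ 3 ≤ 2 * g ^ 3 := by
          have : 10 ≤ g := by omega
          nlinarith [mul_le_mul this this (by omega) (by omega)]
        calc (g + 1) ^ 3 ≤ 2 * g ^ 3 := h1
          _ ≤ 2 * 2 ^ (g + 2) := by omega
          _ = 2 ^ (g + 1 + 2) := by ring

theorem tablesCost_le {n N g : ℕ} (hn : n ≤ N) (hN : 2 ≤ N) (hg : 1 ≤ g) :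
    tablesCost n g ≤ N ^ (g + 9) := by
  have h1 : g ≤ g ^ 3 := Nat.le_self_pow (by norm_num) g
  have h2 : g ^ 2 ≤ g ^ 3 := Nat.pow_le_pow_right hg (by norm_num)
  have h0 : 1 ≤ g ^ 3 := Nat.one_le_pow _ _ hg
  calc tablesCost n g ≤ N * (2 * (g * (g * (3 * g + 3) + 5) + 1) + g + 8) + N * (g * (g + 4) + 6) := by
        unfold tablesCost
        have := Nat.mul_le_mul_right (2 * (g * (g * (3 * g + 3) + 5) + 1) + g + 8) hn
        have := Nat.le_mul_of_pos_left (g * (g + 4) + 6) (show 0 < N by omega)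
        omega
    _ = N * (6 * g ^ 3 + 7 * g ^ 2 + 15 * g + 16) := by ring
    _ ≤ N * (44 * g ^ 3) := Nat.mul_le_mul_left _ (by omega)
    _ ≤ N * (2 ^ 6 * 2 ^ (g + 2)) := by
        exact Nat.mul_le_mul_left _ (Nat.mul_le_mul (by norm_num) (pow_three_le_two_pow g))
    _ = N * 2 ^ (g + 8) := by ring
    _ ≤ N * N ^ (g + 8) := by gcongr
    _ = N ^ (g + 9) := by ring

theorem propagateCost_le {n m N : ℕ} (hn : n ≤ N) (hm : m ≤ N) (hN : 2 ≤ N) :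
    propagateCost n m ≤ 117 * N ^ 2 := by
  calc propagateCost n m ≤ N * 9 + (N + 1) * (N * 66 + 12) + 16 := by
        unfold propagateCost; gcongr
    _ ≤ 117 * N ^ 2 := by nlinarith

theorem satCost_le {n m N : ℕ} (hn : n ≤ N) (hm : m ≤ N) (hN : 2 ≤ N) :
    satCost n m ≤ N ^ 11 := by
  have hc := propagateCost_le hn hm hN
  calc satCost n m ≤ N * (2 * (117 * N ^ 2) + N * 14 + 21) + 5 := by unfold satCost; gcongr
    _ ≤ N * (2 ^ 8 * N ^ 2) := by nlinarith
    _ ≤ N * (N ^ 8 * N ^ 2) := by gcongr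
    _ = N ^ 11 := by ring

theorem searchCost_le {n m N : ℕ} (hn : n ≤ N) (hm : m ≤ N) (hN : 2 ≤ N) (k : ℕ) :
    searchCost n m k ≤ N ^ (k + 11) := by
  have hc := propagateCost_le hn hm hN
  -- The recursion is affine with slope at most `N`; the added term turns it into growth by a factor
  -- of at most `N` per level. Half of that term, times `N`, covers the inhomogeneous part, and the
  -- other half, times `N ≥ 2`, restores the term.
  have key : searchCost n m k + 2 * (117 * N ^ 2 + N * 38 + 43) ≤ N ^ k * (2 ^ 9 * N ^ 2) := by
    induction k with
    | zero => simp only [searchCost]; nlinarith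
    | succ k ih =>
      calc searchCost n m (k + 1) + 2 * (117 * N ^ 2 + N * 38 + 43)
          ≤ N * (117 * N ^ 2 + N * 14 + searchCost n m k + 20) + N * 24 + 23 +
            N * (117 * N ^ 2 + N * 38 + 43) := by
            simp only [searchCost]
            gcongr
        _ ≤ N * (searchCost n m k + 2 * (117 * N ^ 2 + N * 38 + 43)) := by nlinarith
        _ ≤ N * (N ^ k * (2 ^ 9 * N ^ 2)) := by gcongr
        _ = N ^ (k + 1) * (2 ^ 9 * N ^ 2) := by ring
  calc searchCost n m k ≤ N ^ k * (2 ^ 9 * N ^ 2) := by omega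
    _ ≤ N ^ k * (N ^ 9 * N ^ 2) := by gcongr
    _ = N ^ (k + 11) := by ring

end TwoSatMod

theorem mainTheorem1 :
    ∃ c : ℕ, ∀ (G : Type u) [AddCommGroup G] [Finite G] (e : G ≃ Fin (Nat.card G)),
      ∃ P : RAM.Program, ∀ (n m : ℕ) (Φ : TwoSatMod G n m),
        ∃ (s : RAM.State) (t : ℕ), RAM.Exec P (Φ.input e) s t ∧ Φ.IsAnswer s ∧
          (2 ≤ n + m → t ≤ (n + m) ^ (Nat.card G + c)) := by
  -- Each of the three phases takes at most `N ^ (g + 11)` steps, as does the overhead of 6, where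
  -- `N = n + m`; the total factor 4 is at most `N ^ 2`.
  refine ⟨13, fun G _ _ e => ⟨TwoSatMod.solveProgram e, fun n m Φ => ?_⟩⟩
  obtain ⟨s, t, he, ht, ha⟩ := TwoSatMod.runs_solveProgram e Φ
  refine ⟨s, t, he, ha, fun hN => ht.trans ?_⟩
  have hg : 1 ≤ Nat.card G := Nat.card_pos
  generalize Nat.card G = g at hg
  have hn : n ≤ n + m := Nat.le_add_right _ _
  have hm : m ≤ n + m := Nat.le_add_left _ _
  have h1 := TwoSatMod.tablesCost_le hn hN hg
  have h2 := TwoSatMod.satCost_le hn hm hN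
  have h3 := TwoSatMod.searchCost_le hn hm hN (g - 1)
  generalize n + m = N at *
  have e1 : N ^ (g + 9) ≤ N ^ (g + 11) := Nat.pow_le_pow_right (by omega) (by omega)
  have e2 : N ^ 11 ≤ N ^ (g + 11) := Nat.pow_le_pow_right (by omega) (by omega)
  have e3 : N ^ (g - 1 + 11) ≤ N ^ (g + 11) := Nat.pow_le_pow_right (by omega) (by omega)
  have e4 : 6 ≤ N ^ (g + 11) :=
    calc 6 ≤ 2 ^ 11 := by norm_num
      _ ≤ N ^ 11 := Nat.pow_le_pow_left hN 11
      _ ≤ N ^ (g + 11) := e2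
  have e5 : N ^ (g + 13) = N ^ (g + 11) * N ^ 2 := by ring
  have e6 : 4 ≤ N ^ 2 := Nat.pow_le_pow_left hN 2
  rw [e5]
  nlinarith
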